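/- Fix $n\ge 1$. Let $\mathbb{O}$ be the space of symmetric $n\times n$ real matrices $\Omega=(\omega_{ij})$ with nonnegative entries and zero diagonal; let $\mathbf G(\Omega)$ be the graph on $\{1,\dots,n\}$ in which $i,j$ are joined iff $\omega_{ij}>0$, and let $\mathbb{O}_{conn}$ be the set of $\Omega\in\mathbb{O}$ with $\mathbf G(\Omega)$ connected. Let $\partial\mathbb{O}$ be the space of rays from the origin in $\mathbb{O}$, viewed as the boundary at infinity in the radial compactification $\mathbb{O}\cup\partial\mathbb{O}$; the graph $\mathbf G(\Omega^*)$ of a ray $\Omega^*$ is the graph of any matrix on it. Let $\mathbf Q_i(\Omega)=I+D_i\Omega$, where $D_i$ is the diagonal matrix whose only nonzero entry is a $1$ in position $i$. Call a matrix-valued function on $\mathbb{O}$ general if it is a pointwise product of functions $\mathbf Q_1,\dots,\mathbf Q_n$ in which each $\mathbf Q_i$ occurs at least once. For a closed path $\gamma=(i_1 i_2\dots i_K i_1)$ in the complete graph on $\{1,\dots,n\}$ and a tuple $\mathbf p=(p_1,\dots,p_K)$ of positive integers, put $\mathbf M_\gamma^{\mathbf p}=\mathbf Q_{i_K}^{p_K}\cdots\mathbf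 Q_{i_1}^{p_1}$, and let $\partial\mathbb{O}_\gamma=\{\Omega^*\in\partial\mathbb{O}:\gamma\subset\mathbf G(\Omega^*)\}$. For a Perron–Frobenius matrix $M$ (nonnegative entries, some positive power has all entries positive), let $\mathbf W(M)\subset\mathbb{R}^n$ be the codimension-one subspace spanned by the right (generalized, possibly complex) eigenspaces of $M$ for the eigenvalues other than its Perron–Frobenius eigenvalue, i.e. its largest real eigenvalue (more precisely, $\mathbf W(M)$ consists of the real vectors in that complex span), and let $\mathbf f(M):\mathbf W(M)\to\mathbf W(M)$ be the linear map $x\mapsto Mx$. Let $\mathrm{Gr}(n-1,n)$ be the Grassmannian of $(n-1)$-dimensional subspaces of $\mathbb{R}^n$ and $\mathrm{End}(n-1,n)$ the space of linear endomorphisms of its elements, with the topology in which $(f_k:W_k\to W_k)\to(f:W\to W)$ iff $W_k\to W$ and $f_k(v_k)\to f(v)$ whenever $v_k\in W_k$, $v\in W$, $v_k\to v$. Suppose that $\mathbf M_\gamma^{\mathbf p}$ is general. Then $\mathbf M_\gamma^{\mathbf p}(\Omega)$ is Perron–Frobenius for every $\Omega\in\mathbb{O}_{conn}$, so that $\mathbf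 W_\gamma^{\mathbf p}(\Omega)=\mathbf W(\mathbf M_\gamma^{\mathbf p}(\Omega))$ and $\mathbf f_\gamma^{\mathbf p}(\Omega)=\mathbf f(\mathbf M_\gamma^{\mathbf p}(\Omega))$ define maps $\mathbf W_\gamma^{\mathbf p}:\mathbb{O}_{conn}\to\mathrm{Gr}(n-1,n)$ and $\mathbf f_\gamma^{\mathbf p}:\mathbb{O}_{conn}\to\mathrm{End}(n-1,n)$, and both maps extend to continuous maps on $\mathbb{O}_{conn}\cup\partial\mathbb{O}_\gamma\subset\mathbb{O}\cup\partial\mathbb{O}$. The restrictions $\mathbf W_\gamma$, $\mathbf f_\gamma$ of the extensions to $\partial\mathbb{O}_\gamma$ depend only on $\gamma$ and not on $\mathbf p$. Explicitly, if $\Omega$ is any matrix on the ray $\Omega^*\in\partial\mathbb{O}_\gamma$, then $\mathbf W_\gamma(\Omega^*)=\langle e_{i_1}^T\Omega\rangle^\perp$, this subspace is invariant under $$P_\gamma(\Omega)=Q_{i_1\leftarrow i_K}\cdots Q_{i_3\leftarrow i_2}Q_{i_2\leftarrow i_1},\qquad Q_{i\leftarrow j}\,x=x-\frac{e_i^T\Omega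 x}{\omega_{ij}}\,e_j,$$ and $\mathbf f_\gamma(\Omega^*)$ is the restriction of $P_\gamma(\Omega)$ to it. (Each $Q_{i\leftarrow j}$ is the projection onto $\langle e_i^T\Omega\rangle^\perp$ in the direction of $e_j$.) -/

import Mathlib

open Filter Topology

noncomputable section

namespace Penner

/-! ### Subspaces and their endomorphisms -/

/-- The Grassmannian `Gr(k, n)` of `k`-dimensional linear subspaces of `ℝⁿ`. -/
def Gr (k n : ℕ) : Type :=
  {W : Submodule ℝ (EuclideanSpace ℝ (Fin n)) // Module.finrank ℝ W = k}

/-- The usual topology of the Grassmannian: a subspace is identified with the orthogonal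
projection onto it, seen as an operator on `ℝⁿ`. -/
instance Gr.instTopologicalSpace (k n : ℕ) : TopologicalSpace (Gr k n) :=
  TopologicalSpace.induced
    (fun W => (W.1.starProjection :
      EuclideanSpace ℝ (Fin n) →L[ℝ] EuclideanSpace ℝ (Fin n))) inferInstance

/-- A linear subspace of `ℝⁿ` (of any dimension) together with a linear endomorphism of it. -/
def SubEnd (n : ℕ) : Type :=
  (W : Submodule ℝ (EuclideanSpace ℝ (Fin n))) × (W →ₗ[ℝ] W)

/-- The space `End(k, n)` of linear endomorphisms `W → W` of the elements `W` of `Gr(k, n)`. -/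
def EndGr (k n : ℕ) : Type :=
  {F : SubEnd n // Module.finrank ℝ F.1 = k}

/-- The subspace on which an element of `End(k, n)` acts. -/
def EndGr.space {k n : ℕ} (F : EndGr k n) : Gr k n := ⟨F.1.1, F.2⟩

/-- The endomorphism `W → W` underlying an element of `End(k, n)`. -/
def EndGr.map {k n : ℕ} (F : EndGr k n) : F.space.1 →ₗ[ℝ] F.space.1 := F.1.2

/-- The operator on `ℝⁿ` that extends `f : W → W` by zero on the orthogonal complement of `W`. -/
def EndGr.extend {k n : ℕ} (F : EndGr k n) :
    EuclideanSpace ℝ (Fin n) →L[ℝ] EuclideanSpace ℝ (Fin n) :=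
  F.space.1.subtypeL ∘L LinearMap.toContinuousLinearMap F.map ∘L
    F.space.1.orthogonalProjectionOnto

/-- The topology of `End(k, n)`. Its convergent sequences are described by
`EndGr.tendsto_iff` below. -/
instance EndGr.instTopologicalSpace (k n : ℕ) : TopologicalSpace (EndGr k n) :=
  TopologicalSpace.induced (fun F => (F.space, F.extend)) inferInstance

theorem EndGr.extend_coe {k n : ℕ} (F : EndGr k n) (w : F.space.1) :
    F.extend (w : EuclideanSpace ℝ (Fin n)) = F.map w := by
  simp [EndGr.extend]

/-- `f_j → f` in `End(k, n)` if and only if `W_j → W` in `Gr(k, n)` and `f_j(v_j) → f(v)` for all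
sequences `v_j → v` with `v_j ∈ W_j` and `v ∈ W`. -/
theorem EndGr.tendsto_iff {k n : ℕ} (F : ℕ → EndGr k n) (F₀ : EndGr k n) :
    Tendsto F atTop (𝓝 F₀) ↔
      Tendsto (fun j => (F j).space) atTop (𝓝 F₀.space) ∧
      ∀ (v : ∀ j, (F j).space.1) (v₀ : F₀.space.1),
        Tendsto (fun j => (v j : EuclideanSpace ℝ (Fin n))) atTop (𝓝 (v₀ : _)) →
        Tendsto (fun j => ((F j).map (v j) : EuclideanSpace ℝ (Fin n))) atTop
          (𝓝 (F₀.map v₀ : _)) := by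
  have h0 : Tendsto F atTop (𝓝 F₀) ↔ Tendsto (fun j => (F j).space) atTop (𝓝 F₀.space) ∧
      Tendsto (fun j => (F j).extend) atTop (𝓝 F₀.extend) := by
    rw [nhds_induced, tendsto_comap_iff, nhds_prod_eq, tendsto_prod_iff']
    rfl
  rw [h0]
  refine and_congr_right fun hW => ⟨fun h v v₀ hv => ?_, fun h => ?_⟩
  · have := (isBoundedBilinearMap_apply.continuous.tendsto
      (F₀.extend, (v₀ : EuclideanSpace ℝ (Fin n)))).comp (h.prodMk_nhds hv)
    simpa only [Function.comp_def, EndGr.extend_coe] using this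
  · have hW' : Tendsto (fun j => (F j).space.1.starProjection) atTop
        (𝓝 (F₀.space.1.starProjection)) := by
      rw [nhds_induced, tendsto_comap_iff] at hW
      exact hW
    have hpt : ∀ x, Tendsto (fun j => (F j).extend x) atTop (𝓝 (F₀.extend x)) := fun x =>
      h (fun j => (F j).space.1.orthogonalProjectionOnto x) _
        ((isBoundedBilinearMap_apply.continuous.tendsto (F₀.space.1.starProjection, x)).comp
          (hW'.prodMk_nhds tendsto_const_nhds))
    obtain ⟨C, -, hC⟩ := (EuclideanSpace.basisFun (Fin n) ℝ).toBasis.exists_opNorm_le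
      (F := EuclideanSpace ℝ (Fin n))
    rw [tendsto_iff_norm_sub_tendsto_zero]
    have hsum : Tendsto (fun j => C * ∑ i, ‖((F j).extend - F₀.extend)
        ((EuclideanSpace.basisFun (Fin n) ℝ).toBasis i)‖) atTop (𝓝 0) := by
      have : Tendsto (fun j => ∑ i, ‖((F j).extend - F₀.extend)
          ((EuclideanSpace.basisFun (Fin n) ℝ).toBasis i)‖) atTop (𝓝 (∑ _i : Fin n, 0)) :=
        tendsto_finsetSum _ fun i _ => by
          simpa using tendsto_iff_norm_sub_tendsto_zero.1
            (hpt ((EuclideanSpace.basisFun (Fin n) ℝ).toBasis i))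
      simpa using this.const_mul C
    refine squeeze_zero (fun _ => norm_nonneg _) (fun j => hC ?_ fun i => ?_) hsum
    · exact Finset.sum_nonneg fun i _ => norm_nonneg _
    · exact Finset.single_le_sum (f := fun i => ‖((F j).extend - F₀.extend)
        ((EuclideanSpace.basisFun (Fin n) ℝ).toBasis i)‖)
        (fun _ _ => norm_nonneg _) (Finset.mem_univ i)

/-! ### Perron–Frobenius matrices

A matrix is Perron–Frobenius if its entries are nonnegative and some power has positive entries;
this is `Matrix.IsPrimitive`. -/

/-- The Perron–Frobenius eigenvalue: the largest real eigenvalue. -/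
def pfEigenvalue {n : ℕ} (M : Matrix (Fin n) (Fin n) ℝ) : ℝ :=
  sSup {μ : ℝ | Module.End.HasEigenvalue (Matrix.toLin' M) μ}

/-- The inclusion `ℝⁿ → ℂⁿ`. -/
def complexify (n : ℕ) : EuclideanSpace ℝ (Fin n) →ₗ[ℝ] (Fin n → ℂ) where
  toFun v i := (v i : ℂ)
  map_add' v w := by ext i; simp
  map_smul' c v := by ext i; simp

/-- A real matrix acting on `ℂⁿ`. -/
def complexAction {n : ℕ} (M : Matrix (Fin n) (Fin n) ℝ) : Module.End ℂ (Fin n → ℂ) :=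
  Matrix.toLin' (M.map (fun x : ℝ => (x : ℂ)))

/-- The subspace `W(M)` spanned by the right eigenspaces of `M` for the eigenvalues other than the
Perron–Frobenius eigenvalue. Eigenvalues may be complex or defective, so this is the space of real
vectors in the complex span of the generalized eigenspaces. -/
def bW {n : ℕ} (M : Matrix (Fin n) (Fin n) ℝ) : Submodule ℝ (EuclideanSpace ℝ (Fin n)) :=
  ((⨆ μ : {μ : ℂ // μ ≠ (pfEigenvalue M : ℂ)},
    (complexAction M).maxGenEigenspace μ.1).restrictScalars ℝ).comap (complexify n)

theorem complexify_toEuclideanLin {n : ℕ} (M : Matrix (Fin n) (Fin n) ℝ)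
    (v : EuclideanSpace ℝ (Fin n)) :
    complexify n (Matrix.toEuclideanLin M v) = complexAction M (complexify n v) := by
  ext i
  simp [complexify, complexAction, Matrix.toLpLin_apply, Matrix.mulVec, dotProduct]

theorem bW_invariant {n : ℕ} (M : Matrix (Fin n) (Fin n) ℝ) :
    ∀ v ∈ bW M, Matrix.toEuclideanLin M v ∈ bW M := by
  intro v hv
  have hinv : (⨆ μ : {μ : ℂ // μ ≠ (pfEigenvalue M : ℂ)},
      (complexAction M).maxGenEigenspace μ.1) ≤
      (⨆ μ : {μ : ℂ // μ ≠ (pfEigenvalue M : ℂ)},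
        (complexAction M).maxGenEigenspace μ.1).comap (complexAction M) := by
    refine iSup_le fun μ => fun (x : Fin n → ℂ) hx => ?_
    exact (le_iSup (fun μ : {μ : ℂ // μ ≠ (pfEigenvalue M : ℂ)} =>
      (complexAction M).maxGenEigenspace μ.1) μ)
      (Module.End.mapsTo_maxGenEigenspace_of_comm (Commute.refl (complexAction M)) μ.1 hx)
  rw [bW, Submodule.mem_comap, complexify_toEuclideanLin]
  exact hinv hv

/-- The endomorphism `f(M) : W(M) → W(M)` induced by multiplication by `M`. -/
def bf {n : ℕ} (M : Matrix (Fin n) (Fin n) ℝ) : SubEnd n :=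
  ⟨bW M, (Matrix.toEuclideanLin M).restrict (bW_invariant M)⟩

/-! ### Generalized intersection matrices and their rays -/

/-- The space `𝕆` of generalized intersection matrices: symmetric, nonnegative entries, zero
diagonal. -/
def OO (n : ℕ) : Set (Matrix (Fin n) (Fin n) ℝ) :=
  {Ω | Ω.IsSymm ∧ (∀ i j, 0 ≤ Ω i j) ∧ ∀ i, Ω i i = 0}

/-- The graph `G(Ω)`: the vertices `i` and `j` are joined if the `(i, j)`-entry is positive. -/
def graph {n : ℕ} (Ω : OO n) : SimpleGraph (Fin n) where
  Adj i j := 0 < Ω.1 i j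
  symm := ⟨fun i j h => by rw [← Ω.2.1.apply]; exact h⟩
  loopless := ⟨fun i h => by rw [Ω.2.2.2 i] at h; exact lt_irrefl _ h⟩

/-- The set of `Ω ∈ 𝕆` with connected graph. -/
def OOconn (n : ℕ) : Set (OO n) := {Ω | (graph Ω).Connected}

/-- `∂𝕆`: the rays from the origin inside `𝕆`. -/
def BdOO (n : ℕ) : Type :=
  {r : Module.Ray ℝ (Matrix (Fin n) (Fin n) ℝ) //
    ∃ (Ω : OO n) (h : Ω.1 ≠ 0), r = rayOfNeZero ℝ Ω.1 h}

/-- `Ω` is a nonzero matrix on the ray `r`. -/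
def BdOO.Rep {n : ℕ} (r : BdOO n) (Ω : OO n) : Prop :=
  ∃ h : Ω.1 ≠ 0, r.1 = rayOfNeZero ℝ Ω.1 h

/-- A matrix on the ray `r`. -/
def BdOO.rep {n : ℕ} (r : BdOO n) : OO n := Classical.choose r.2

theorem BdOO.rep_spec {n : ℕ} (r : BdOO n) : r.Rep r.rep := Classical.choose_spec r.2

/-- The sum of the entries of a matrix; on `𝕆` it is the `ℓ¹`-norm. -/
def entrySum {n : ℕ} (Ω : Matrix (Fin n) (Fin n) ℝ) : ℝ := ∑ i, ∑ j, Ω i j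

/-- The compactification `𝕆 ∪ ∂𝕆`. -/
inductive OBar (n : ℕ) : Type
  | fin (Ω : OO n) : OBar n
  | inf (r : BdOO n) : OBar n

/-- The radial embedding of `𝕆 ∪ ∂𝕆` onto the closed unit ball `{|Ω| ≤ 1}` of `𝕆`:
a point of `𝕆` goes to `Ω / (1 + |Ω|)`, and a ray goes to its unit vector. -/
def OBar.radial {n : ℕ} : OBar n → Matrix (Fin n) (Fin n) ℝ
  | .fin Ω => (1 + entrySum Ω.1)⁻¹ • Ω.1
  | .inf r => (entrySum r.rep.1)⁻¹ • r.rep.1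

/-- The unit vector of a ray does not depend on the matrix chosen on it. -/
theorem OBar.radial_inf {n : ℕ} (r : BdOO n) (Ω : OO n) (h : r.Rep Ω) :
    OBar.radial (.inf r) = (entrySum Ω.1)⁻¹ • Ω.1 := by
  obtain ⟨h₀, e₀⟩ := r.rep_spec
  obtain ⟨h₁, e₁⟩ := h
  obtain ⟨a, b, ha, hb, hab⟩ :=
    ((ray_eq_iff h₀ h₁).1 (e₀.symm.trans e₁)).exists_pos h₀ h₁
  have hΩ : Ω.1 = (b⁻¹ * a) • r.rep.1 := by
    rw [mul_smul, hab, smul_smul, inv_mul_cancel₀ hb.ne', one_smul]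
  have hc : (b⁻¹ * a) ≠ 0 := (mul_pos (inv_pos.2 hb) ha).ne'
  have hs : entrySum Ω.1 = (b⁻¹ * a) * entrySum r.rep.1 := by
    rw [hΩ]
    simp [entrySum, Finset.mul_sum]
  rw [hs, hΩ, smul_smul, mul_inv, mul_comm (b⁻¹ * a)⁻¹, mul_assoc, inv_mul_cancel₀ hc, mul_one]
  rfl

/-- The topology of the radial compactification `𝕆 ∪ ∂𝕆`. -/
instance OBar.instTopologicalSpace (n : ℕ) : TopologicalSpace (OBar n) :=
  TopologicalSpace.induced OBar.radial inferInstance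

/-! ### The monoid of Penner matrices -/

/-- The generator `Q_i(Ω) = I + D_i Ω`, as a matrix-valued function on `𝕆`. -/
def bQ {n : ℕ} (i : Fin n) : OO n → Matrix (Fin n) (Fin n) ℝ :=
  fun Ω => 1 + Matrix.single i i (1 : ℝ) * Ω.1

/-- The general elements of the monoid generated by `Q_1, …, Q_n`: the products in which every
generator appears. -/
def GammaGen (n : ℕ) : Set (OO n → Matrix (Fin n) (Fin n) ℝ) :=
  {M | ∃ l : List (Fin n), (∀ i, i ∈ l) ∧ M = (l.map bQ).prod}

/-- For a closed path `γ = (i_1 … i_K i_1)` in the complete graph and exponents `p_1, …, p_K`, the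
element `Q_{i_K}^{p_K} ⋯ Q_{i_1}^{p_1}`. -/
def bM {n : ℕ} {v : Fin n} (γ : (⊤ : SimpleGraph (Fin n)).Walk v v) (p : Fin γ.length → ℕ) :
    OO n → Matrix (Fin n) (Fin n) ℝ :=
  (List.ofFn fun k : Fin γ.length => bQ (γ.getVert k.1) ^ p k).reverse.prod

/-- `∂𝕆_γ`: the rays whose graph contains every edge of `γ`. -/
def BdOOgamma {n : ℕ} {v : Fin n} (γ : (⊤ : SimpleGraph (Fin n)).Walk v v) : Set (BdOO n) :=
  {r | ∀ e ∈ γ.edges, e ∈ (graph r.rep).edgeSet}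

/-- The union of `{Ω ∈ 𝕆 : G(Ω) connected}` and `∂𝕆_γ` inside the compactification. -/
def extDomain {n : ℕ} {v : Fin n} (γ : (⊤ : SimpleGraph (Fin n)).Walk v v) : Set (OBar n) :=
  OBar.fin '' OOconn n ∪ OBar.inf '' BdOOgamma γ

/-- The function `F₀` on `∂𝕆_γ` extends continuously the function `F` on the connected generalized
intersection matrices: glued together, they form a continuous function. -/
def ExtendsContinuouslyBy {n : ℕ} {v : Fin n} (γ : (⊤ : SimpleGraph (Fin n)).Walk v v)
    {X : Type*} [TopologicalSpace X] (F : OOconn n → X) (F₀ : BdOOgamma γ → X) : Prop :=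
  ∃ Fbar : extDomain γ → X, Continuous Fbar ∧
    (∀ (Ω : OO n) (h : Ω ∈ OOconn n),
      Fbar ⟨.fin Ω, Or.inl ⟨Ω, h, rfl⟩⟩ = F ⟨Ω, h⟩) ∧
    ∀ (r : BdOO n) (h : r ∈ BdOOgamma γ),
      Fbar ⟨.inf r, Or.inr ⟨r, h, rfl⟩⟩ = F₀ ⟨r, h⟩

/-- The matrix `Q_{i ← j}(Ω) = I - ω_{ij}⁻¹ T_{ji} Ω`, where `T_{ji}` is the matrix unit. It is used
only for edges `ij` of `G(Ω)`. -/
def Qproj {n : ℕ} (i j : Fin n) (Ω : OO n) : Matrix (Fin n) (Fin n) ℝ :=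
  1 - (Ω.1 i j)⁻¹ • (Matrix.single j i (1 : ℝ) * Ω.1)

/-- For `γ = (i_1 … i_K i_1)`, the composition `Q_{i_1 ← i_K} ⋯ Q_{i_3 ← i_2} Q_{i_2 ← i_1}`. -/
def Pgamma {n : ℕ} {v : Fin n} (γ : (⊤ : SimpleGraph (Fin n)).Walk v v) (Ω : OO n) :
    Matrix (Fin n) (Fin n) ℝ :=
  (List.ofFn fun k : Fin γ.length =>
    Qproj (γ.getVert (k.1 + 1)) (γ.getVert k.1) Ω).reverse.prod

/-- The subspace `(e_i^T Ω)^⊥`, orthogonal to the `i`th row of `Ω`. -/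
def rowPerp {n : ℕ} (i : Fin n) (Ω : OO n) : Submodule ℝ (EuclideanSpace ℝ (Fin n)) :=
  (ℝ ∙ (WithLp.toLp 2 (Ω.1 i) : EuclideanSpace ℝ (Fin n)))ᗮ

/-- For an edge `ij`, the matrix `Q_{i ← j}` acts as the projection onto the hyperplane
`(e_i^T Ω)^⊥` in the direction of `e_j`. -/
theorem Qproj_isProjection {n : ℕ} (i j : Fin n) (Ω : OO n) (h : (graph Ω).Adj i j)
    (x : EuclideanSpace ℝ (Fin n)) :
    Matrix.toEuclideanLin (Qproj i j Ω) x ∈ rowPerp i Ω ∧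
    (x ∈ rowPerp i Ω → Matrix.toEuclideanLin (Qproj i j Ω) x = x) ∧
    ∃ c : ℝ, Matrix.toEuclideanLin (Qproj i j Ω) x = x - c • EuclideanSpace.single j (1 : ℝ) := by
  have h' : 0 < Ω.1 i j := h
  have hmem : ∀ y : EuclideanSpace ℝ (Fin n), y ∈ rowPerp i Ω ↔ ∑ l, Ω.1 i l * y l = 0 := by
    intro y
    rw [rowPerp, Submodule.mem_orthogonal_singleton_iff_inner_right, PiLp.inner_apply]
    simp [mul_comm]
  have key : Matrix.toEuclideanLin (Qproj i j Ω) x =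
      x - ((Ω.1 i j)⁻¹ * ∑ l, Ω.1 i l * x l) • EuclideanSpace.single j (1 : ℝ) := by
    ext m
    rw [Matrix.toLpLin_apply, Qproj, Matrix.sub_mulVec, Matrix.smul_mulVec, Matrix.one_mulVec]
    have hrow : ∀ l, (Matrix.single j i (1 : ℝ) * Ω.1) m l = if m = j then Ω.1 i l else 0 := by
      intro l
      by_cases hm : m = j
      · subst hm
        simp
      · simp [hm]
    simp only [Matrix.mulVec, dotProduct, PiLp.sub_apply, PiLp.smul_apply, Pi.sub_apply,
      Pi.smul_apply, smul_eq_mul, hrow]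
    by_cases hm : m = j <;> simp [hm]
  refine ⟨?_, fun hx => ?_, _, key⟩
  · rw [hmem, key]
    simp only [PiLp.sub_apply, PiLp.smul_apply, smul_eq_mul, mul_sub, Finset.sum_sub_distrib]
    simp [h'.ne', mul_comm]
  · rw [key, (hmem x).1 hx]
    simp

end Penner

end

/-!
Why the extensions exist. Write `γ = (i_0 i_1 … i_K)` with `i_K = i_0`, and `M(Ω)` for the product
of the `Q_{i_k}(Ω) ^ p_k`.

For a primitive matrix `M` with Perron–Frobenius left eigenvector `u`, the space `W(M)` is the
hyperplane orthogonal to `u` (`bW_eq_perp`), so everything reduces to the behaviour of `u`. In the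
coordinate `S = Ω / (1 + |Ω|)` of the radial compactification, the factors `Q_{i_k}(Ω) ^ p_k` are,
up to positive scalars, the matrices `(1 - |S|) I + p_k D_{i_k} S`, which make sense and are
continuous up to the boundary `|S| = 1` (`scaledFactor`). At a boundary point whose graph contains
`γ`, their product has rank one, with row space spanned by the row `e_{i_0}ᵀ S`, and is not
nilpotent. Hence at all points of the domain there is exactly one left eigenvector `u` in the
simplex whose eigenvalue satisfies a suitable closed lower bound (`IsPFVec`), and compactness of the
simplex makes `u` continuous (`continuous_of_isPFVec`). At infinity `u` is proportional to
`e_{i_0}ᵀ Ω`, whatever the exponents.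

The entries of `M(Ω)` blow up at infinity, but its restriction to the orthogonal complement of `u`
does not. Let `w_k` be the product of the row `u` with the factors of index at least `k`
(`partialRow`). If `x` is orthogonal to `u`, then its image under the factors of index less than `k`
is orthogonal to `w_k`. As the factor of index `k` changes a vector only by a multiple of `e_{i_k}`,
it acts on this image as the projection onto the hyperplane orthogonal to `w_{k+1}` in the direction
of `e_{i_k}` (`prodDown_mulVec_eq`). The product of these projections is continuous up to the
boundary, where `w_{k+1}` is proportional to `e_{i_{k+1}}ᵀ Ω` and the projections are the
`Q_{i_{k+1} ← i_k}` that define `P_γ` (`prodDown_projAlong_partialRow_inf`).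
-/

namespace Penner

section PerronFrobenius

open Matrix

/-! ### Perron–Frobenius theory for primitive matrices -/

variable {ι : Type*} [Fintype ι]

theorem vecMul_pos {P : Matrix ι ι ℝ} (hP : ∀ i j, 0 < P i j) {x : ι → ℝ} (hx : ∀ i, 0 ≤ x i)
    {i₀ : ι} (hi : x i₀ ≠ 0) (j : ι) : 0 < (x ᵥ* P) j :=
  Finset.sum_pos' (fun i _ => mul_nonneg (hx i) (hP i j).le)
    ⟨i₀, Finset.mem_univ _, mul_pos ((hx i₀).lt_of_ne' hi) (hP i₀ j)⟩

theorem exists_ne_zero_of_mem_stdSimplex {x : ι → ℝ} (hx : x ∈ stdSimplex ℝ ι) :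
    ∃ i, x i ≠ 0 := by
  by_contra! h
  have := hx.2
  simp [h] at this

theorem dotProduct_mulVec_of_left_eigen {M : Matrix ι ι ℝ} {u : ι → ℝ} {r : ℝ}
    (h : u ᵥ* M = r • u) (x : ι → ℝ) : u ⬝ᵥ M *ᵥ x = r * u ⬝ᵥ x := by
  rw [dotProduct_mulVec, h, smul_dotProduct, smul_eq_mul]

variable [DecidableEq ι]

theorem isPrimitive_transpose {M : Matrix ι ι ℝ} (hM : M.IsPrimitive) : Mᵀ.IsPrimitive := by
  obtain ⟨h0, k, hk, hpos⟩ := hM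
  exact ⟨fun i j => h0 j i, k, hk, fun i j => by rw [← transpose_pow]; exact hpos j i⟩

theorem isPrimitive_smul {M : Matrix ι ι ℝ} (hM : M.IsPrimitive) {c : ℝ} (hc : 0 < c) :
    (c • M).IsPrimitive := by
  obtain ⟨h0, k, hk, hpos⟩ := hM
  refine ⟨fun i j => mul_nonneg hc.le (h0 i j), k, hk, fun i j => ?_⟩
  rw [smul_pow]
  exact mul_pos (pow_pos hc k) (hpos i j)

theorem vecMul_pow_of_eigen {M : Matrix ι ι ℝ} {x : ι → ℝ} {r : ℝ} (h : x ᵥ* M = r • x) (k : ℕ) :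
    x ᵥ* M ^ k = r ^ k • x := by
  induction k with
  | zero => simp
  | succ k ih => rw [pow_succ, ← vecMul_vecMul, ih, smul_vecMul, h, smul_smul, pow_succ]

/-- A nonnegative nonzero left eigenvector of a primitive matrix has positive entries. -/
theorem eigen_pos {M : Matrix ι ι ℝ} (hM : M.IsPrimitive) {x : ι → ℝ} (hx : ∀ i, 0 ≤ x i)
    {i₀ : ι} (hi : x i₀ ≠ 0) {r : ℝ} (h : x ᵥ* M = r • x) (j : ι) : 0 < x j := by
  obtain ⟨-, k, -, hpos⟩ := hM
  have := vecMul_pos hpos hx hi j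
  rw [vecMul_pow_of_eigen h] at this
  refine (hx j).lt_of_ne fun h0 => ?_
  simp [← h0] at this

/-- Existence of a Perron–Frobenius left eigenvector. Following Collatz and Wielandt, one maximizes
the `t` with `t u ≤ u M` for some `u` in the simplex; if `u M ≠ t u` at the maximum, then the vector
`u Mᵏ`, with `Mᵏ` positive, allows a larger `t`. -/
theorem exists_left_eigen [Nonempty ι] {M : Matrix ι ι ℝ} (hM : M.IsPrimitive) :
    ∃ u ∈ stdSimplex ℝ ι, ∃ r : ℝ, u ᵥ* M = r • u := by
  obtain ⟨h0, k, -, hpos⟩ := hM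
  have hbound : ∀ (t : ℝ) (u : ι → ℝ), u ∈ stdSimplex ℝ ι → (∀ j, t * u j ≤ (u ᵥ* M) j) →
      t ≤ ∑ j, ∑ i, M i j := by
    intro t u hu ht
    calc t = ∑ j, t * u j := by rw [← Finset.mul_sum, hu.2, mul_one]
      _ ≤ ∑ j, ∑ i, M i j := Finset.sum_le_sum fun j _ => (ht j).trans
          (Finset.sum_le_sum fun i _ => mul_le_of_le_one_left (h0 i j)
            (stdSimplex.le_one ⟨u, hu⟩ i))
  set C : Set (ℝ × (ι → ℝ)) :=
    (Set.Icc 0 (∑ j, ∑ i, M i j) ×ˢ stdSimplex ℝ ι) ∩ {q | ∀ j, q.1 * q.2 j ≤ (q.2 ᵥ* M) j} with hC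
  have hCc : IsCompact C := by
    refine (isCompact_Icc.prod (isCompact_stdSimplex ℝ ι)).inter_right ?_
    simp only [Set.ofPred_forall]
    refine isClosed_iInter fun j => isClosed_le (by fun_prop) ?_
    exact (continuous_apply j).comp (Continuous.matrix_vecMul continuous_snd continuous_const)
  have hCn : C.Nonempty := by
    obtain ⟨i⟩ := ‹Nonempty ι›
    have hmem := single_mem_stdSimplex ℝ i
    have hge : ∀ j, (0 : ℝ) * (Pi.single i 1 : ι → ℝ) j ≤ ((Pi.single i 1 : ι → ℝ) ᵥ* M) j := by
      intro j
      simpa using h0 i j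
    exact ⟨(0, Pi.single i 1), ⟨⟨le_rfl, hbound 0 _ hmem hge⟩, hmem⟩, hge⟩
  obtain ⟨⟨r, u⟩, ⟨⟨⟨hr0, hrB⟩, hu⟩, hge⟩, hmax⟩ :=
    hCc.exists_isMaxOn hCn continuous_fst.continuousOn
  simp only at hr0 hrB hu hge
  refine ⟨u, hu, r, ?_⟩
  by_contra hne
  obtain ⟨j₀, hj₀⟩ : ∃ j, (u ᵥ* M - r • u) j ≠ 0 := by
    by_contra! h
    exact hne (sub_eq_zero.1 (funext h))
  obtain ⟨i₀, hi₀⟩ := exists_ne_zero_of_mem_stdSimplex hu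
  have hw := vecMul_pos hpos hu.1 hi₀
  have hy := vecMul_pos hpos (x := u ᵥ* M - r • u) (fun j => by simpa using hge j) hj₀
  set w := u ᵥ* M ^ k
  have hwM : w ᵥ* M = r • w + (u ᵥ* M - r • u) ᵥ* M ^ k := by
    rw [sub_vecMul, smul_vecMul, vecMul_vecMul, vecMul_vecMul, ← pow_succ, pow_succ']
    abel
  set y := (u ᵥ* M - r • u) ᵥ* M ^ k
  obtain ⟨ε, hε, hle⟩ : ∃ ε > 0, ∀ j, ε * w j ≤ y j := by
    obtain ⟨j, hj⟩ := Finite.exists_min fun j => y j / w j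
    exact ⟨y j / w j, div_pos (hy j) (hw j), fun i => (le_div_iff₀ (hw i)).1 (hj i)⟩
  have hs : 0 < ∑ j, w j := Finset.sum_pos (fun j _ => hw j) Finset.univ_nonempty
  have hw' : (∑ j, w j)⁻¹ • w ∈ stdSimplex ℝ ι :=
    ⟨fun j => mul_nonneg (inv_nonneg.2 hs.le) (hw j).le, by
      simp only [Pi.smul_apply, smul_eq_mul, ← Finset.mul_sum]
      exact inv_mul_cancel₀ hs.ne'⟩
  have hge' : ∀ j, (r + ε) * ((∑ j, w j)⁻¹ • w) j ≤ (((∑ j, w j)⁻¹ • w) ᵥ* M) j := by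
    intro j
    rw [smul_vecMul, hwM]
    simp only [Pi.smul_apply, Pi.add_apply, smul_eq_mul]
    rw [mul_left_comm]
    exact mul_le_mul_of_nonneg_left (by linarith [hle j]) (inv_nonneg.2 hs.le)
  have hmem : (r + ε, (∑ j, w j)⁻¹ • w) ∈ C :=
    ⟨⟨⟨by positivity, hbound _ _ hw' hge'⟩, hw'⟩, hge'⟩
  have : r + ε ≤ r := hmax hmem
  linarith

/-- The positive part of an eigenvector for the Perron–Frobenius eigenvalue is again an eigenvector,
hence vanishes or has no zero entry; the latter is impossible for a vector orthogonal to the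
positive left eigenvector `u`. -/
theorem right_eigen_nonpos {M : Matrix ι ι ℝ} (hM : M.IsPrimitive) {u : ι → ℝ}
    (hu : ∀ i, 0 < u i) {r : ℝ} (h : u ᵥ* M = r • u) {x : ι → ℝ} (hx : M *ᵥ x = r • x)
    (hux : u ⬝ᵥ x = 0) (i : ι) : x i ≤ 0 := by
  set y : ι → ℝ := fun i => max (x i) 0 with hy
  have hy0 : ∀ i, 0 ≤ y i := fun i => le_max_right _ _
  have hge : ∀ i, r * y i ≤ (M *ᵥ y) i := by
    intro i
    rcases le_or_gt (x i) 0 with hi | hi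
    · rw [hy]
      simp only [max_eq_right hi, mul_zero]
      exact Finset.sum_nonneg fun j _ => mul_nonneg (hM.nonneg i j) (hy0 j)
    · have h1 : y i = x i := max_eq_left hi.le
      have h2 : r * x i = (M *ᵥ x) i := by rw [hx]; rfl
      rw [h1, h2]
      exact Finset.sum_le_sum fun j _ => mul_le_mul_of_nonneg_left (le_max_left _ _) (hM.nonneg i j)
  have hsum : ∑ i, u i * ((M *ᵥ y) i - r * y i) = 0 := by
    have := dotProduct_mulVec_of_left_eigen h y
    simp only [dotProduct, Finset.mul_sum] at this
    simp only [mul_sub, Finset.sum_sub_distrib, this, sub_eq_zero]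
    exact Finset.sum_congr rfl fun i _ => by ring
  have heq : y ᵥ* Mᵀ = r • y := by
    rw [vecMul_transpose]
    funext i
    have := (Finset.sum_eq_zero_iff_of_nonneg fun i _ =>
      mul_nonneg (hu i).le (sub_nonneg.2 (hge i))).1 hsum i (Finset.mem_univ i)
    exact sub_eq_zero.1 ((mul_eq_zero.1 this).resolve_left (hu i).ne')
  by_contra! hi
  have hyi : y i ≠ 0 := (lt_max_of_lt_left hi).ne'
  have hpos : ∀ j, 0 < x j := fun j => by
    have := eigen_pos (isPrimitive_transpose hM) hy0 hyi heq j
    simpa [hy] using this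
  exact (Finset.sum_pos (fun j _ => mul_pos (hu j) (hpos j)) ⟨i, Finset.mem_univ i⟩).ne' hux

theorem right_eigen_eq_zero {M : Matrix ι ι ℝ} (hM : M.IsPrimitive) {u : ι → ℝ}
    (hu : ∀ i, 0 < u i) {r : ℝ} (h : u ᵥ* M = r • u) {x : ι → ℝ} (hx : M *ᵥ x = r • x)
    (hux : u ⬝ᵥ x = 0) : x = 0 := by
  funext i
  refine le_antisymm (right_eigen_nonpos hM hu h hx hux i) ?_
  have := right_eigen_nonpos hM hu h (x := -x) (by rw [mulVec_neg, hx, smul_neg])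
    (by rw [dotProduct_neg, hux, neg_zero]) i
  simpa using this

/-- A primitive matrix has a positive right eigenvector, for the same eigenvalue as any positive
left eigenvector. -/
theorem exists_right_eigen [Nonempty ι] {M : Matrix ι ι ℝ} (hM : M.IsPrimitive) {u : ι → ℝ}
    (hu : ∀ i, 0 ≤ u i) {i₀ : ι} (hi : u i₀ ≠ 0) {r : ℝ} (h : u ᵥ* M = r • u) :
    ∃ v : ι → ℝ, (∀ i, 0 < v i) ∧ M *ᵥ v = r • v := by
  obtain ⟨v, hv, r', hr'⟩ := exists_left_eigen (isPrimitive_transpose hM)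
  obtain ⟨j, hj⟩ := exists_ne_zero_of_mem_stdSimplex hv
  have hpos := eigen_pos (isPrimitive_transpose hM) hv.1 hj hr'
  rw [vecMul_transpose] at hr'
  refine ⟨v, hpos, ?_⟩
  have huv : 0 < u ⬝ᵥ v := Finset.sum_pos' (fun i _ => mul_nonneg (hu i) (hpos i).le)
    ⟨i₀, Finset.mem_univ _, mul_pos ((hu i₀).lt_of_ne' hi) (hpos i₀)⟩
  have := dotProduct_mulVec_of_left_eigen h v
  rw [hr', dotProduct_smul, smul_eq_mul] at this
  rw [hr', mul_right_cancel₀ huv.ne' this]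

/-- The Perron–Frobenius left eigenvector in the simplex is unique. -/
theorem left_eigen_unique [Nonempty ι] {M : Matrix ι ι ℝ} (hM : M.IsPrimitive) {u w : ι → ℝ}
    (hu : u ∈ stdSimplex ℝ ι) (hw : w ∈ stdSimplex ℝ ι) {r s : ℝ} (hr : u ᵥ* M = r • u)
    (hs : w ᵥ* M = s • w) : w = u := by
  obtain ⟨i, hi⟩ := exists_ne_zero_of_mem_stdSimplex hu
  obtain ⟨j, hj⟩ := exists_ne_zero_of_mem_stdSimplex hw
  obtain ⟨v, hv, hvr⟩ := exists_right_eigen hM hu.1 hi hr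
  have hupos : 0 < u ⬝ᵥ v := Finset.sum_pos' (fun i _ => mul_nonneg (hu.1 i) (hv i).le)
    ⟨i, Finset.mem_univ _, mul_pos ((hu.1 i).lt_of_ne' hi) (hv i)⟩
  have hwpos : 0 < w ⬝ᵥ v := Finset.sum_pos' (fun i _ => mul_nonneg (hw.1 i) (hv i).le)
    ⟨j, Finset.mem_univ _, mul_pos ((hw.1 j).lt_of_ne' hj) (hv j)⟩
  have hrs : r = s := by
    have := dotProduct_mulVec_of_left_eigen hs v
    rw [hvr, dotProduct_smul, smul_eq_mul] at this
    exact mul_right_cancel₀ hwpos.ne' this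
  subst hrs
  have hz : w - ((w ⬝ᵥ v) / (u ⬝ᵥ v)) • u = 0 := by
    refine right_eigen_eq_zero (isPrimitive_transpose hM) hv
      (by rw [vecMul_transpose]; exact hvr) (x := w - ((w ⬝ᵥ v) / (u ⬝ᵥ v)) • u) ?_ ?_
    · rw [mulVec_transpose, sub_vecMul, smul_vecMul, hr, hs, smul_sub, smul_comm]
    · rw [dotProduct_comm, sub_dotProduct, smul_dotProduct, smul_eq_mul,
        div_mul_cancel₀ _ hupos.ne', sub_self]
  have hw' := sub_eq_zero.1 hz
  have h1 := hw.2
  rw [hw'] at h1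
  simp only [Pi.smul_apply, smul_eq_mul, ← Finset.mul_sum, hu.2, mul_one] at h1
  rw [hw', h1, one_smul]

end PerronFrobenius

section Eigenspaces

open Matrix

variable {n : ℕ}

/-! ### The invariant hyperplane complementary to the Perron–Frobenius eigenvector -/

theorem pfEigenvalue_eq [NeZero n] {M : Matrix (Fin n) (Fin n) ℝ} (hM : M.IsPrimitive)
    {u : Fin n → ℝ} (hu : ∀ i, 0 < u i) {r : ℝ} (h : u ᵥ* M = r • u) : pfEigenvalue M = r := by
  refine IsGreatest.csSup_eq ⟨?_, ?_⟩
  · obtain ⟨v, hv, hvr⟩ := exists_right_eigen hM (fun i => (hu i).le) (hu 0).ne' h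
    refine Module.End.hasEigenvalue_of_hasEigenvector (x := v)
      ⟨Module.End.mem_eigenspace_iff.2 (by simpa using hvr), fun h0 => ?_⟩
    have := hv 0
    simp [h0] at this
  · rintro μ hμ
    obtain ⟨x, hx, hx0⟩ := hμ.exists_hasEigenvector
    rw [Module.End.mem_eigenspace_iff, toLin'_apply] at hx
    obtain ⟨i₀, hi₀⟩ := Function.ne_iff.1 hx0
    have hge : ∀ i, μ * |x i| ≤ (M *ᵥ fun j => |x j|) i := by
      intro i
      have h1 : μ * x i = (M *ᵥ x) i := by rw [hx]; rfl
      calc μ * |x i| ≤ |μ * x i| := by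
            rw [abs_mul]; exact mul_le_mul_of_nonneg_right (le_abs_self μ) (abs_nonneg _)
        _ ≤ ∑ j, |M i j * x j| := by
            rw [h1]; exact Finset.abs_sum_le_sum_abs (fun j => M i j * x j) Finset.univ
        _ = (M *ᵥ fun j => |x j|) i := Finset.sum_congr rfl fun j _ => by
            rw [abs_mul, abs_of_nonneg (hM.nonneg i j)]
    have hpos : 0 < u ⬝ᵥ fun j => |x j| :=
      Finset.sum_pos' (fun i _ => mul_nonneg (hu i).le (abs_nonneg _))
        ⟨i₀, Finset.mem_univ _, mul_pos (hu i₀) (abs_pos.2 hi₀)⟩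
    refine le_of_mul_le_mul_right ?_ hpos
    rw [← dotProduct_mulVec_of_left_eigen h, dotProduct, Finset.mul_sum]
    refine Finset.sum_le_sum fun i _ => ?_
    rw [mul_left_comm]
    exact mul_le_mul_of_nonneg_left (hge i) (hu i).le

/-- The complex linear form `y ↦ ∑ uᵢ yᵢ` of a real vector `u`. -/
def complexForm (u : Fin n → ℝ) : (Fin n → ℂ) →ₗ[ℂ] ℂ :=
  ∑ i, (u i : ℂ) • LinearMap.proj i

theorem complexForm_apply (u : Fin n → ℝ) (y : Fin n → ℂ) :
    complexForm u y = ∑ i, (u i : ℂ) * y i := by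
  simp [complexForm]

theorem complexForm_sub_pow {M : Matrix (Fin n) (Fin n) ℝ} {u : Fin n → ℝ} {r : ℝ}
    (h : u ᵥ* M = r • u) (μ : ℂ) (k : ℕ) (y : Fin n → ℂ) :
    complexForm u (((complexAction M - algebraMap ℂ _ μ) ^ k) y) =
      ((r : ℂ) - μ) ^ k * complexForm u y := by
  have hstep : ∀ z, complexForm u (complexAction M z) = (r : ℂ) * complexForm u z := by
    intro z
    simp only [complexForm_apply, complexAction, toLin'_apply, mulVec, dotProduct, map_apply,
      Finset.mul_sum]
    rw [Finset.sum_comm]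
    refine Finset.sum_congr rfl fun j _ => ?_
    have hj : ∑ i, (u i : ℂ) * (M i j : ℂ) = (r : ℂ) * (u j : ℂ) := by
      exact_mod_cast congrFun h j
    rw [← mul_assoc, ← hj, Finset.sum_mul]
    exact Finset.sum_congr rfl fun i _ => by ring
  induction k generalizing y with
  | zero => simp
  | succ k ih =>
    rw [pow_succ, Module.End.mul_apply, ih, LinearMap.sub_apply, map_sub, hstep,
      Module.algebraMap_end_apply, map_smul, smul_eq_mul]
    ring

theorem complexAction_eigen_eq_zero {M : Matrix (Fin n) (Fin n) ℝ} (hM : M.IsPrimitive)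
    {u : Fin n → ℝ} (hu : ∀ i, 0 < u i) {r : ℝ} (h : u ᵥ* M = r • u) {y : Fin n → ℂ}
    (hy : complexAction M y = (r : ℂ) • y) (huy : complexForm u y = 0) : y = 0 := by
  have hy' : ∀ i, ∑ j, (M i j : ℂ) * y j = (r : ℂ) * y i := fun i => by
    simpa [complexAction, mulVec, dotProduct] using congrFun hy i
  rw [complexForm_apply] at huy
  have hre : (fun i => (y i).re) = 0 := by
    refine right_eigen_eq_zero hM hu h (funext fun i => ?_) ?_
    · simpa [mulVec, dotProduct] using congrArg Complex.re (hy' i)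
    · simpa [dotProduct] using congrArg Complex.re huy
  have him : (fun i => (y i).im) = 0 := by
    refine right_eigen_eq_zero hM hu h (funext fun i => ?_) ?_
    · simpa [mulVec, dotProduct] using congrArg Complex.im (hy' i)
    · simpa [dotProduct] using congrArg Complex.im huy
  funext i
  exact Complex.ext (congrFun hre i) (congrFun him i)

/-- The left eigenvector `u` kills every generalized eigenspace except the one of its own
eigenvalue `r`, and no nonzero vector of that one: the Perron–Frobenius eigenvalue is simple. -/
theorem iSup_maxGenEigenspace_eq_ker {M : Matrix (Fin n) (Fin n) ℝ} (hM : M.IsPrimitive)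
    {u : Fin n → ℝ} (hu : ∀ i, 0 < u i) {r : ℝ} (h : u ᵥ* M = r • u) :
    (⨆ μ : {μ : ℂ // μ ≠ (r : ℂ)}, (complexAction M).maxGenEigenspace μ.1) =
      LinearMap.ker (complexForm u) := by
  have hle : (⨆ μ : {μ : ℂ // μ ≠ (r : ℂ)}, (complexAction M).maxGenEigenspace μ.1) ≤
      LinearMap.ker (complexForm u) := by
    refine iSup_le fun μ y hy => ?_
    obtain ⟨k, hk⟩ := (Module.End.mem_maxGenEigenspace _ _ _).1 hy
    have := complexForm_sub_pow h μ.1 k y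
    rw [show algebraMap ℂ (Module.End ℂ (Fin n → ℂ)) μ.1 = μ.1 • 1 from
      Algebra.algebraMap_eq_smul_one _, hk, map_zero] at this
    exact (mul_eq_zero.1 this.symm).resolve_left (pow_ne_zero _ (sub_ne_zero.2 μ.2.symm))
  refine le_antisymm hle fun x hx => ?_
  have htop := Module.End.iSup_maxGenEigenspace_eq_top (complexAction M)
  rw [iSup_split_single _ (r : ℂ), iSup_subtype'] at htop
  obtain ⟨y, hy, z, hz, rfl⟩ := Submodule.mem_sup.1 (htop ▸ Submodule.mem_top : x ∈ _)
  have hyk : complexForm u y = 0 := by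
    rw [LinearMap.mem_ker, map_add] at hx
    rwa [LinearMap.mem_ker.1 (hle hz), add_zero] at hx
  have hy0 : y = 0 := by
    obtain ⟨k, hk⟩ := (Module.End.mem_maxGenEigenspace _ _ _).1 hy
    rw [← Algebra.algebraMap_eq_smul_one] at hk
    clear hy hx
    induction k generalizing y with
    | zero => simpa using hk
    | succ k ih =>
      rw [pow_succ, Module.End.mul_apply] at hk
      have h1 := ih ((complexAction M - algebraMap ℂ _ (r : ℂ)) y)
        (by simpa using complexForm_sub_pow h (r : ℂ) 1 y) hk
      rw [LinearMap.sub_apply, Module.algebraMap_end_apply, sub_eq_zero] at h1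
      exact complexAction_eigen_eq_zero hM hu h h1 hyk
  rw [hy0, zero_add]
  exact hz

/-- The hyperplane of vectors orthogonal to `u`. -/
noncomputable def perp (u : Fin n → ℝ) : Submodule ℝ (EuclideanSpace ℝ (Fin n)) :=
  (ℝ ∙ (WithLp.toLp 2 u : EuclideanSpace ℝ (Fin n)))ᗮ

theorem mem_perp {u : Fin n → ℝ} {x : EuclideanSpace ℝ (Fin n)} : x ∈ perp u ↔ u ⬝ᵥ x.ofLp = 0 := by
  rw [perp, Submodule.mem_orthogonal_singleton_iff_inner_right, PiLp.inner_apply]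
  simp [dotProduct, mul_comm]

theorem perp_smul {c : ℝ} (hc : c ≠ 0) (u : Fin n → ℝ) : perp (c • u) = perp u := by
  ext x
  simp [mem_perp, smul_dotProduct, hc]

theorem finrank_perp {u : Fin n → ℝ} (hu : u ≠ 0) : Module.finrank ℝ (perp u) = n - 1 := by
  have h1 := Submodule.finrank_add_finrank_orthogonal
    (ℝ ∙ (WithLp.toLp 2 u : EuclideanSpace ℝ (Fin n)))
  rw [finrank_span_singleton (by simpa using hu), finrank_euclideanSpace_fin] at h1
  have h2 : Module.finrank ℝ (perp u) =
    Module.finrank ℝ (ℝ ∙ (WithLp.toLp 2 u : EuclideanSpace ℝ (Fin n)))ᗮ := rfl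
  omega

theorem bW_eq_perp [NeZero n] {M : Matrix (Fin n) (Fin n) ℝ} (hM : M.IsPrimitive)
    {u : Fin n → ℝ} (hu : u ∈ stdSimplex ℝ (Fin n)) {r : ℝ} (h : u ᵥ* M = r • u) :
    bW M = perp u := by
  obtain ⟨i, hi⟩ := exists_ne_zero_of_mem_stdSimplex hu
  have hpos := eigen_pos hM hu.1 hi h
  ext x
  rw [bW, Submodule.mem_comap, Submodule.restrictScalars_mem, pfEigenvalue_eq hM hpos h,
    iSup_maxGenEigenspace_eq_ker hM hpos h, LinearMap.mem_ker, complexForm_apply, mem_perp]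
  simp only [complexify, LinearMap.coe_mk, AddHom.coe_mk, dotProduct]
  exact_mod_cast Iff.rfl

end Eigenspaces

section Products

open Matrix

variable {n : ℕ}

/-! ### Descending products and orbits -/

/-- The product `A (k - 1) * ⋯ * A 1 * A 0`. -/
def prodDown (A : ℕ → Matrix (Fin n) (Fin n) ℝ) : ℕ → Matrix (Fin n) (Fin n) ℝ
  | 0 => 1
  | k + 1 => A k * prodDown A k

theorem prodDown_succ' (A : ℕ → Matrix (Fin n) (Fin n) ℝ) (k : ℕ) :
    prodDown A (k + 1) = prodDown (fun j => A (j + 1)) k * A 0 := by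
  induction k with
  | zero => simp [prodDown]
  | succ k ih => rw [prodDown, ih, prodDown, mul_assoc]

theorem prod_reverse_ofFn (A : ℕ → Matrix (Fin n) (Fin n) ℝ) (K : ℕ) :
    (List.ofFn fun k : Fin K => A k).reverse.prod = prodDown A K := by
  induction K with
  | zero => simp [prodDown]
  | succ K ih =>
    rw [List.ofFn_succ', List.concat_eq_append, List.reverse_append, List.prod_append]
    simp [prodDown, ← ih]

theorem prodDown_smul (c : ℝ) (A : ℕ → Matrix (Fin n) (Fin n) ℝ) (K : ℕ) :
    prodDown (fun k => c • A k) K = c ^ K • prodDown A K := by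
  induction K with
  | zero => simp [prodDown]
  | succ K ih => rw [prodDown, ih, prodDown, smul_mul_smul_comm, pow_succ']

theorem prodDown_congr {A B : ℕ → Matrix (Fin n) (Fin n) ℝ} {K : ℕ} (h : ∀ k < K, A k = B k) :
    prodDown A K = prodDown B K := by
  induction K with
  | zero => rfl
  | succ K ih =>
    rw [prodDown, prodDown, h K K.lt_succ_self, ih fun k hk => h k (hk.trans K.lt_succ_self)]

theorem continuous_prodDown {X : Type*} [TopologicalSpace X]
    {A : X → ℕ → Matrix (Fin n) (Fin n) ℝ} (K : ℕ)
    (h : ∀ k < K, Continuous fun x => A x k) : Continuous fun x => prodDown (A x) K := by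
  induction K with
  | zero => exact continuous_const
  | succ K ih =>
    exact (h K K.lt_succ_self).matrix_mul (ih fun k hk => h k (hk.trans K.lt_succ_self))

/-- The row vector `u * A (K - 1) * ⋯ * A k`. If `u` is a left eigenvector of the full product
`A (K - 1) * ⋯ * A 0`, then these are left eigenvectors of its cyclic permutations. -/
def partialRow (A : ℕ → Matrix (Fin n) (Fin n) ℝ) (K : ℕ) (u : Fin n → ℝ) (k : ℕ) : Fin n → ℝ :=
  u ᵥ* prodDown (fun j => A (j + k)) (K - k)

theorem partialRow_self (A : ℕ → Matrix (Fin n) (Fin n) ℝ) (K : ℕ) (u : Fin n → ℝ) :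
    partialRow A K u K = u := by
  simp [partialRow, prodDown]

theorem partialRow_zero (A : ℕ → Matrix (Fin n) (Fin n) ℝ) (K : ℕ) (u : Fin n → ℝ) :
    partialRow A K u 0 = u ᵥ* prodDown A K := rfl

theorem partialRow_step (A : ℕ → Matrix (Fin n) (Fin n) ℝ) {K : ℕ} (u : Fin n → ℝ) {k : ℕ}
    (hk : k < K) : partialRow A K u k = partialRow A K u (k + 1) ᵥ* A k := by
  obtain ⟨m, rfl⟩ : ∃ m, K = k + 1 + m := ⟨K - (k + 1), by omega⟩
  rw [partialRow, partialRow, vecMul_vecMul, show k + 1 + m - k = m + 1 by omega,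
    show k + 1 + m - (k + 1) = m by omega, prodDown_succ', zero_add]
  simp only [add_assoc, add_comm 1 k]

/-- The matrix `x ↦ x - (w · x / w_j) e_j`, the projection onto the hyperplane orthogonal to `w`
in the direction of `e_j`. -/
noncomputable def projAlong (w : Fin n → ℝ) (j : Fin n) : Matrix (Fin n) (Fin n) ℝ :=
  1 - (w j)⁻¹ • vecMulVec (Pi.single j 1) w

theorem projAlong_mulVec (w : Fin n → ℝ) (j : Fin n) (x : Fin n → ℝ) :
    projAlong w j *ᵥ x = x - ((w j)⁻¹ * w ⬝ᵥ x) • Pi.single j 1 := by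
  rw [projAlong, sub_mulVec, one_mulVec, smul_mulVec, vecMulVec_mulVec, op_smul_eq_smul,
    smul_smul]

theorem projAlong_smul {c : ℝ} (hc : c ≠ 0) (w : Fin n → ℝ) (j : Fin n) :
    projAlong (c • w) j = projAlong w j := by
  rw [projAlong, projAlong, vecMulVec_smul, smul_smul]
  congr 2
  simp only [Pi.smul_apply, smul_eq_mul]
  field_simp

theorem dotProduct_projAlong {w : Fin n → ℝ} {j : Fin n} (hj : w j ≠ 0) (x : Fin n → ℝ) :
    w ⬝ᵥ projAlong w j *ᵥ x = 0 := by
  rw [projAlong_mulVec, dotProduct_sub, dotProduct_smul, dotProduct_single, smul_eq_mul]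
  field_simp
  ring

theorem Qproj_eq_projAlong (i j : Fin n) (Ω : OO n) : Qproj i j Ω = projAlong (Ω.1 i) j := by
  rw [Qproj, projAlong]
  congr 2
  ext a b
  rcases eq_or_ne a j with rfl | h
  · simp [vecMulVec_apply]
  · simp [vecMulVec_apply, h]

/-- On the hyperplane orthogonal to a left eigenvector `u` of `A (K - 1) * ⋯ * A 0`, each factor
moves the orbit of a vector from the hyperplane orthogonal to one partial row to that of the next.
A factor that changes vectors only in the direction of `e_{i k}` is therefore determined there by
the target hyperplane. -/
theorem prodDown_mulVec_eq {A B : ℕ → Matrix (Fin n) (Fin n) ℝ} {K : ℕ} {u : Fin n → ℝ} {r s : ℝ}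
    {i : ℕ → Fin n} (hs : s ≠ 0) (hA : ∀ k, A k = s • B k)
    (hB : ∀ k x, ∃ c : ℝ, B k *ᵥ x = x + c • Pi.single (i k) 1) (hu : u ᵥ* prodDown A K = r • u)
    (hne : ∀ k < K, partialRow A K u (k + 1) (i k) ≠ 0) {x : Fin n → ℝ} (hx : u ⬝ᵥ x = 0) :
    prodDown B K *ᵥ x = prodDown (fun k => projAlong (partialRow A K u (k + 1)) (i k)) K *ᵥ x := by
  have key : ∀ k ≤ K, partialRow A K u k ⬝ᵥ prodDown B k *ᵥ x = 0 ∧ prodDown B k *ᵥ x =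
      prodDown (fun k => projAlong (partialRow A K u (k + 1)) (i k)) k *ᵥ x := by
    intro k
    induction k with
    | zero =>
      intro _
      simp [prodDown, partialRow_zero, hu, smul_dotProduct, hx]
    | succ k ih =>
      intro hk
      obtain ⟨h1, h2⟩ := ih (by omega)
      have h3 : partialRow A K u (k + 1) ⬝ᵥ prodDown B (k + 1) *ᵥ x = 0 := by
        rw [partialRow_step A u hk, ← dotProduct_mulVec, hA, smul_mulVec, dotProduct_smul,
          mulVec_mulVec, smul_eq_mul] at h1
        exact (mul_eq_zero.1 h1).resolve_left hs
      refine ⟨h3, ?_⟩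
      obtain ⟨c, hc⟩ := hB k (prodDown B k *ᵥ x)
      have h4 : prodDown B k *ᵥ x = prodDown B (k + 1) *ᵥ x - c • Pi.single (i k) 1 := by
        rw [prodDown, ← mulVec_mulVec, hc, add_sub_cancel_right]
      rw [prodDown.eq_2 (fun k => projAlong (partialRow A K u (k + 1)) (i k)), ← mulVec_mulVec,
        ← h2, projAlong_mulVec]
      rw [h4, dotProduct_sub, h3, dotProduct_smul, dotProduct_single, smul_eq_mul]
      have := hne k hk
      rw [zero_sub, mul_one, mul_neg, mul_comm c, inv_mul_cancel_left₀ this, neg_smul]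
      abel
  exact (key K le_rfl).2

end Products

section Topology

open Matrix

variable {n : ℕ}

/-! ### Continuity of Perron–Frobenius vectors -/

/-- A left eigenvector `u` in the simplex whose eigenvalue, which is the sum of the entries of
`u N`, is bounded below by the diagonal entry `N j j`. The bound is a closed condition; it holds for
the Perron–Frobenius vector of a primitive matrix, and rules out the kernel of a limit of such
matrices that has rank one and a positive entry `N j j`. -/
def IsPFVec (N : Matrix (Fin n) (Fin n) ℝ) (j : Fin n) (u : Fin n → ℝ) : Prop :=
  u ∈ stdSimplex ℝ (Fin n) ∧ u ᵥ* N = (∑ l, (u ᵥ* N) l) • u ∧ N j j ≤ ∑ l, (u ᵥ* N) l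

theorem isPFVec_of_eigen {N : Matrix (Fin n) (Fin n) ℝ} (hN : ∀ i j, 0 ≤ N i j) {j : Fin n}
    {u : Fin n → ℝ} (hu : u ∈ stdSimplex ℝ (Fin n)) {r : ℝ} (h : u ᵥ* N = r • u) (hj : u j ≠ 0) :
    IsPFVec N j u := by
  have hr : ∑ l, (u ᵥ* N) l = r := by
    simp [h, ← Finset.mul_sum, hu.2]
  refine ⟨hu, by rw [hr, h], ?_⟩
  rw [hr]
  have hpos : 0 < u j := (hu.1 j).lt_of_ne' hj
  refine le_of_mul_le_mul_right ?_ hpos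
  have : r * u j = (u ᵥ* N) j := by rw [h]; rfl
  rw [this, mul_comm]
  exact Finset.single_le_sum (f := fun i => u i * N i j) (fun i _ => mul_nonneg (hu.1 i) (hN i j))
    (Finset.mem_univ j)

theorem existsUnique_isPFVec [NeZero n] {N : Matrix (Fin n) (Fin n) ℝ} (hN : N.IsPrimitive)
    (j : Fin n) : ∃! u, IsPFVec N j u := by
  obtain ⟨u, hu, r, hr⟩ := exists_left_eigen hN
  obtain ⟨i, hi⟩ := exists_ne_zero_of_mem_stdSimplex hu
  exact ⟨u, isPFVec_of_eigen hN.nonneg hu hr (eigen_pos hN hu.1 hi hr j).ne',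
    fun w hw => left_eigen_unique hN hu hw.1 hr hw.2.1⟩

/-- A function into the compact simplex that is characterized by a closed condition is
continuous. -/
theorem continuous_of_isPFVec {X : Type*} [TopologicalSpace X]
    {N : X → Matrix (Fin n) (Fin n) ℝ} (hN : Continuous N) (j : Fin n) {u : X → Fin n → ℝ}
    (hu : ∀ x, IsPFVec (N x) j (u x)) (huniq : ∀ x w, IsPFVec (N x) j w → w = u x) :
    Continuous u := by
  have : CompactSpace (stdSimplex ℝ (Fin n)) :=
    isCompact_iff_compactSpace.1 (isCompact_stdSimplex ℝ (Fin n))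
  have hvec : Continuous fun q : X × stdSimplex ℝ (Fin n) => (q.2 : Fin n → ℝ) ᵥ* N q.1 :=
    (continuous_subtype_val.comp continuous_snd).matrix_vecMul (hN.comp continuous_fst)
  have hsum : Continuous fun q : X × stdSimplex ℝ (Fin n) =>
      ∑ l, ((q.2 : Fin n → ℝ) ᵥ* N q.1) l :=
    continuous_finsetSum _ fun l _ => (continuous_apply l).comp hvec
  have hclosed : IsClosed {q : X × stdSimplex ℝ (Fin n) | IsPFVec (N q.1) j q.2} := by
    have : {q : X × stdSimplex ℝ (Fin n) | IsPFVec (N q.1) j q.2} =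
        {q | (q.2 : Fin n → ℝ) ᵥ* N q.1 =
          (∑ l, ((q.2 : Fin n → ℝ) ᵥ* N q.1) l) • (q.2 : Fin n → ℝ)} ∩
        {q | N q.1 j j ≤ ∑ l, ((q.2 : Fin n → ℝ) ᵥ* N q.1) l} := by
      ext q
      exact ⟨fun h => h.2, fun h => ⟨q.2.2, h⟩⟩
    rw [this]
    exact (isClosed_eq hvec (hsum.smul (continuous_subtype_val.comp continuous_snd))).inter
      (isClosed_le ((hN.comp continuous_fst).matrix_elem j j) hsum)
  suffices h : Continuous fun x => (⟨u x, (hu x).1⟩ : stdSimplex ℝ (Fin n)) from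
    continuous_subtype_val.comp h
  refine continuous_iff_isClosed.2 fun C hC => ?_
  have := isClosedMap_fst_of_compactSpace (X := X) (Y := stdSimplex ℝ (Fin n)) _
    (hclosed.inter (hC.preimage continuous_snd))
  convert this using 1
  ext x
  constructor
  · exact fun hx => ⟨(x, ⟨u x, (hu x).1⟩), ⟨hu x, hx⟩, rfl⟩
  · rintro ⟨⟨y, w⟩, ⟨hw, hwC⟩, rfl⟩
    have : w = ⟨u y, (hu y).1⟩ := Subtype.ext (huniq y w hw)
    rw [this] at hwC
    exact hwC

/-! ### Continuous families in the Grassmannian and in the space of endomorphisms -/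

theorem starProjection_perp {u : Fin n → ℝ} :
    (perp u).starProjection =
      Matrix.toEuclideanCLM (n := Fin n) (𝕜 := ℝ) (1 - (u ⬝ᵥ u)⁻¹ • vecMulVec u u) := by
  ext x i
  have hn : ‖(WithLp.toLp 2 u : EuclideanSpace ℝ (Fin n))‖ ^ 2 = u ⬝ᵥ u := by
    rw [EuclideanSpace.real_norm_sq_eq]
    simp [dotProduct, sq]
  rw [perp, Submodule.starProjection_orthogonal', Matrix.ofLp_toEuclideanCLM, sub_mulVec,
    one_mulVec, smul_mulVec, vecMulVec_mulVec]
  simp only [_root_.sub_apply, one_apply_eq_self,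
    Submodule.starProjection_singleton, PiLp.inner_apply]
  simp only [hn, RCLike.ofReal_real_eq_id, id_eq, PiLp.sub_apply, PiLp.smul_apply, smul_eq_mul,
    Pi.sub_apply, Pi.smul_apply]
  simp [dotProduct, div_eq_inv_mul, mul_comm, mul_left_comm]

theorem continuous_toEuclideanCLM :
    Continuous (Matrix.toEuclideanCLM (n := Fin n) (𝕜 := ℝ)) :=
  LinearMap.continuous_of_finiteDimensional
    (Matrix.toEuclideanCLM (n := Fin n) (𝕜 := ℝ)).toAlgEquiv.toLinearMap

theorem continuous_starProjection_perp {X : Type*} [TopologicalSpace X] {u : X → Fin n → ℝ}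
    (hu : Continuous u) (h0 : ∀ x, u x ≠ 0) : Continuous fun x => (perp (u x)).starProjection := by
  simp only [starProjection_perp]
  have h1 : Continuous fun x => (u x ⬝ᵥ u x)⁻¹ :=
    (hu.dotProduct hu).inv₀ fun x => by simpa using h0 x
  exact continuous_toEuclideanCLM.comp
    (continuous_const.sub (h1.smul (hu.matrix_vecMulVec hu)))

/-- The hyperplane orthogonal to a nonzero vector, as an element of the Grassmannian. -/
noncomputable def perpGr (u : Fin n → ℝ) (h0 : u ≠ 0) : Gr (n - 1) n :=
  ⟨perp u, finrank_perp h0⟩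

theorem continuous_perpGr {X : Type*} [TopologicalSpace X] {u : X → Fin n → ℝ}
    (hu : Continuous u) (h0 : ∀ x, u x ≠ 0) :
    Continuous fun x => perpGr (u x) (h0 x) :=
  continuous_induced_rng.2 (continuous_starProjection_perp hu h0)

/-- The endomorphism of a subspace induced by a matrix that preserves it. -/
noncomputable def restrictEnd (W : Submodule ℝ (EuclideanSpace ℝ (Fin n)))
    (P : Matrix (Fin n) (Fin n) ℝ) (h : ∀ x ∈ W, Matrix.toEuclideanLin P x ∈ W) : SubEnd n :=
  ⟨W, (Matrix.toEuclideanLin P).restrict h⟩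

theorem restrictEnd_congr {W W' : Submodule ℝ (EuclideanSpace ℝ (Fin n))}
    {P P' : Matrix (Fin n) (Fin n) ℝ} {h : ∀ x ∈ W, Matrix.toEuclideanLin P x ∈ W}
    {h' : ∀ x ∈ W', Matrix.toEuclideanLin P' x ∈ W'} (hW : W = W')
    (hP : ∀ x ∈ W, P *ᵥ x.ofLp = P' *ᵥ x.ofLp) : restrictEnd W P h = restrictEnd W' P' h' := by
  subst hW
  refine congrArg (Sigma.mk W) (LinearMap.ext fun x => Subtype.ext ?_)
  exact congrArg (WithLp.toLp 2) (hP x x.2)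

/-- The endomorphism induced by a matrix on an invariant hyperplane, as an element of
`End(n - 1, n)`. -/
noncomputable def perpEnd (u : Fin n → ℝ) (h0 : u ≠ 0) (P : Matrix (Fin n) (Fin n) ℝ)
    (h : ∀ x ∈ perp u, Matrix.toEuclideanLin P x ∈ perp u) : EndGr (n - 1) n :=
  ⟨restrictEnd (perp u) P h, finrank_perp h0⟩

theorem continuous_perpEnd {X : Type*} [TopologicalSpace X] {u : X → Fin n → ℝ}
    (hu : Continuous u) (h0 : ∀ x, u x ≠ 0) {P : X → Matrix (Fin n) (Fin n) ℝ} (hP : Continuous P)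
    (h : ∀ x, ∀ y ∈ perp (u x), Matrix.toEuclideanLin (P x) y ∈ perp (u x)) :
    Continuous fun x => perpEnd (u x) (h0 x) (P x) (h x) := by
  refine continuous_induced_rng.2 ((continuous_perpGr hu h0).prodMk ?_)
  exact (continuous_toEuclideanCLM.comp hP).clm_comp (continuous_starProjection_perp hu h0)

end Topology

section Primitive

open Matrix

variable {n : ℕ}

/-! ### General products are primitive on connected graphs -/

theorem le_mul_of_one_le {A B : Matrix (Fin n) (Fin n) ℝ}
    (hA : ∀ i j, (1 : Matrix (Fin n) (Fin n) ℝ) i j ≤ A i j)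
    (hB : ∀ i j, (1 : Matrix (Fin n) (Fin n) ℝ) i j ≤ B i j) (i j : Fin n) :
    A i j ≤ (A * B) i j ∧ B i j ≤ (A * B) i j := by
  have h1 : ∀ i j, (0 : ℝ) ≤ (1 : Matrix (Fin n) (Fin n) ℝ) i j := fun i j => by
    rw [one_apply]; split_ifs <;> norm_num
  constructor
  · have h : (A * B) i j = A i j + (A * (B - 1)) i j := by
      rw [mul_sub, mul_one, Matrix.sub_apply]; ring
    rw [h, mul_apply (N := B - 1)]
    exact le_add_of_nonneg_right (Finset.sum_nonneg fun l _ =>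
      mul_nonneg ((h1 i l).trans (hA i l)) (sub_nonneg.2 (hB l j)))
  · have h : (A * B) i j = B i j + ((A - 1) * B) i j := by
      rw [sub_mul, one_mul, Matrix.sub_apply]; ring
    rw [h, mul_apply (M := A - 1)]
    exact le_add_of_nonneg_right (Finset.sum_nonneg fun l _ =>
      mul_nonneg (sub_nonneg.2 (hA i l)) ((h1 l j).trans (hB l j)))

theorem le_list_prod_of_one_le (l : List (Matrix (Fin n) (Fin n) ℝ))
    (hl : ∀ A ∈ l, ∀ i j, (1 : Matrix (Fin n) (Fin n) ℝ) i j ≤ A i j) :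
    (∀ i j, (1 : Matrix (Fin n) (Fin n) ℝ) i j ≤ l.prod i j) ∧
      ∀ A ∈ l, ∀ i j, A i j ≤ l.prod i j := by
  induction l with
  | nil => simp
  | cons B l ih =>
    obtain ⟨h1, h2⟩ := ih fun A hA => hl A (List.mem_cons_of_mem _ hA)
    have hB := hl B List.mem_cons_self
    rw [List.prod_cons]
    refine ⟨fun i j => (hB i j).trans (le_mul_of_one_le hB h1 i j).1, fun A hA i j => ?_⟩
    rcases List.mem_cons.1 hA with rfl | hA
    · exact (le_mul_of_one_le hB h1 i j).1
    · exact (h2 A hA i j).trans (le_mul_of_one_le hB h1 i j).2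

theorem bQ_apply (i : Fin n) (Ω : OO n) (a b : Fin n) :
    bQ i Ω a b = (1 : Matrix (Fin n) (Fin n) ℝ) a b + if a = i then Ω.1 i b else 0 := by
  rw [bQ, Matrix.add_apply]
  by_cases h : a = i
  · subst h; simp
  · simp [h]

theorem one_le_bQ (i : Fin n) (Ω : OO n) (a b : Fin n) :
    (1 : Matrix (Fin n) (Fin n) ℝ) a b ≤ bQ i Ω a b := by
  rw [bQ_apply]
  refine le_add_of_nonneg_right ?_
  split_ifs
  exacts [Ω.2.2.1 _ _, le_rfl]

/-- A walk of length `k` in the graph makes an entry of `Mᵏ` positive, and the positive diagonal of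
`M` keeps it positive in all higher powers. -/
theorem isPrimitive_of_connected {Ω : OO n} (hΩ : (graph Ω).Connected)
    {M : Matrix (Fin n) (Fin n) ℝ} (h1 : ∀ i j, (1 : Matrix (Fin n) (Fin n) ℝ) i j ≤ M i j)
    (h2 : ∀ i j, Ω.1 i j ≤ M i j) : M.IsPrimitive := by
  have h0 : ∀ i j, 0 ≤ M i j := fun i j => (Ω.2.2.1 i j).trans (h2 i j)
  have hpow : ∀ k i j, 0 ≤ (M ^ k) i j := fun k i j => pow_apply_nonneg h0 k i j
  have hd : ∀ i, 0 < M i i := fun i => lt_of_lt_of_le (by simp) (h1 i i)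
  have hwalk : ∀ {i j} (w : (graph Ω).Walk i j), 0 < (M ^ w.length) i j := by
    intro i j w
    induction w with
    | nil => simp
    | @cons a b c hab w ih =>
      rw [SimpleGraph.Walk.length_cons, pow_succ', mul_apply]
      exact Finset.sum_pos' (fun l _ => mul_nonneg (h0 _ _) (hpow _ _ _))
        ⟨b, Finset.mem_univ _, mul_pos (lt_of_lt_of_le hab (h2 a b)) ih⟩
  have hmono : ∀ {i j} {k m : ℕ}, k ≤ m → 0 < (M ^ k) i j → 0 < (M ^ m) i j := by
    intro i j k m hkm hk
    induction hkm with
    | refl => exact hk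
    | step _ ih =>
      rw [pow_succ, mul_apply]
      exact Finset.sum_pos' (fun l _ => mul_nonneg (hpow _ _ _) (h0 _ _))
        ⟨j, Finset.mem_univ _, mul_pos ih (hd j)⟩
  have hconn : ∀ q : Fin n × Fin n, ∃ k, 0 < (M ^ k) q.1 q.2 := fun q =>
    ⟨_, hwalk (hΩ.preconnected q.1 q.2).some⟩
  choose k hk using hconn
  -- One exponent larger than the lengths of walks between all pairs of vertices.
  refine ⟨h0, ∑ q, k q + 1, Nat.succ_pos _, fun i j => hmono ?_ (hk (i, j))⟩
  exact (Finset.single_le_sum (fun _ _ => Nat.zero_le _) (Finset.mem_univ (i, j))).trans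
    (Nat.le_succ _)

theorem isPrimitive_of_mem_gammaGen {F : OO n → Matrix (Fin n) (Fin n) ℝ} (hF : F ∈ GammaGen n)
    {Ω : OO n} (hΩ : Ω ∈ OOconn n) : (F Ω).IsPrimitive := by
  obtain ⟨l, hl, rfl⟩ := hF
  have hprod : (l.map bQ).prod Ω = (l.map fun i => bQ i Ω).prod := by
    have := map_list_prod (Pi.evalMonoidHom (fun _ : OO n => Matrix (Fin n) (Fin n) ℝ) Ω) (l.map bQ)
    rwa [List.map_map] at this
  rw [hprod]
  obtain ⟨h1, h2⟩ := le_list_prod_of_one_le (l.map fun i => bQ i Ω) (by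
    intro A hA
    obtain ⟨i, -, rfl⟩ := List.mem_map.1 hA
    exact one_le_bQ i Ω)
  refine isPrimitive_of_connected hΩ h1 fun i j =>
    le_trans ?_ (h2 _ (List.mem_map_of_mem (hl i)) i j)
  rw [bQ_apply, if_pos rfl]
  refine le_add_of_nonneg_left ?_
  rw [one_apply]; split_ifs <;> norm_num

/-- The matrix of the complete graph with all weights one. -/
def completeOO (n : ℕ) : OO n :=
  ⟨Matrix.of fun i j => if i = j then 0 else 1,
    Matrix.IsSymm.ext fun i j => by simp [eq_comm],
    fun i j => by simp only [of_apply]; split_ifs <;> norm_num, fun i => by simp⟩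

theorem completeOO_mem_OOconn [NeZero n] : completeOO n ∈ OOconn n := by
  have : graph (completeOO n) = ⊤ := by
    ext i j
    simp only [graph, completeOO, of_apply, SimpleGraph.top_adj]
    split_ifs with h <;> simp [h]
  rw [OOconn, Set.mem_ofPred_eq, this]
  exact SimpleGraph.connected_top

end Primitive

section Factors

open Matrix

variable {n : ℕ}

/-! ### The generators in the coordinates of the radial compactification -/

/-- The factor `(1 - |S|) I + p D_i S`. If `S = Ω / (1 + |Ω|)`, it is a positive multiple of
`Q_i(Ω) ^ p = I + p D_i Ω`, and it depends continuously on `S` up to the boundary `|S| = 1`. -/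
noncomputable def scaledFactor (p : ℕ) (i : Fin n) (S : Matrix (Fin n) (Fin n) ℝ) :
    Matrix (Fin n) (Fin n) ℝ :=
  (1 - entrySum S) • 1 + (p : ℝ) • (Matrix.single i i (1 : ℝ) * S)

theorem continuous_scaledFactor (p : ℕ) (i : Fin n) : Continuous (scaledFactor p i) := by
  have h : Continuous (entrySum (n := n)) :=
    continuous_finsetSum _ fun a _ => continuous_finsetSum _ fun b _ =>
      continuous_id.matrix_elem a b
  unfold scaledFactor
  fun_prop

theorem single_mul_eq_vecMulVec (i j : Fin n) (S : Matrix (Fin n) (Fin n) ℝ) :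
    Matrix.single i j (1 : ℝ) * S = vecMulVec (Pi.single i 1) (S j) := by
  ext a b
  rcases eq_or_ne a i with rfl | h
  · simp [vecMulVec_apply]
  · simp [vecMulVec_apply, h]

theorem bQ_pow (i : Fin n) (Ω : OO n) (p : ℕ) :
    bQ i Ω ^ p = 1 + (p : ℝ) • (Matrix.single i i (1 : ℝ) * Ω.1) := by
  have h0 : (Matrix.single i i (1 : ℝ) * Ω.1) * (Matrix.single i i (1 : ℝ) * Ω.1) = 0 := by
    rw [single_mul_eq_vecMulVec, vecMulVec_mul_vecMulVec]
    simp [Ω.2.2.2 i]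
  induction p with
  | zero => simp
  | succ p ih =>
    rw [pow_succ, ih, bQ, add_mul, mul_add, mul_add, smul_mul_assoc, smul_mul_assoc, h0,
      Nat.cast_succ, add_smul]
    simp only [one_mul, mul_one, smul_zero, one_smul, add_zero]
    abel

theorem entrySum_smul (c : ℝ) (S : Matrix (Fin n) (Fin n) ℝ) :
    entrySum (c • S) = c * entrySum S := by
  simp [entrySum, Finset.mul_sum]

theorem entrySum_nonneg (Ω : OO n) : 0 ≤ entrySum Ω.1 :=
  Finset.sum_nonneg fun i _ => Finset.sum_nonneg fun j _ => Ω.2.2.1 i j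

theorem entrySum_pos {Ω : OO n} (h : Ω.1 ≠ 0) : 0 < entrySum Ω.1 := by
  refine (entrySum_nonneg Ω).lt_of_ne fun h0 => h ?_
  ext i j
  have h1 := (Finset.sum_eq_zero_iff_of_nonneg fun i _ =>
    Finset.sum_nonneg fun j _ => Ω.2.2.1 i j).1 h0.symm i (Finset.mem_univ i)
  exact (Finset.sum_eq_zero_iff_of_nonneg fun j _ => Ω.2.2.1 i j).1 h1 j (Finset.mem_univ j)

theorem scaledFactor_radial_fin (p : ℕ) (i : Fin n) (Ω : OO n) :
    scaledFactor p i (OBar.radial (.fin Ω)) = (1 + entrySum Ω.1)⁻¹ • bQ i Ω ^ p := by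
  have h : 1 + entrySum Ω.1 ≠ 0 := by linarith [entrySum_nonneg Ω]
  have h1 : 1 - (1 + entrySum Ω.1)⁻¹ * entrySum Ω.1 = (1 + entrySum Ω.1)⁻¹ := by
    field_simp
    ring
  rw [scaledFactor, OBar.radial, entrySum_smul, h1, bQ_pow, smul_add, Matrix.mul_smul, smul_comm]

theorem partialRow_pos {A : ℕ → Matrix (Fin n) (Fin n) ℝ} (h0 : ∀ k i j, 0 ≤ A k i j)
    (hd : ∀ k i, 0 < A k i i) {K : ℕ} {u : Fin n → ℝ} (hu : ∀ i, 0 < u i) {k : ℕ} (hk : k ≤ K)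
    (j : Fin n) : 0 < partialRow A K u k j := by
  induction hk using Nat.decreasingInduction generalizing j with
  | self => rw [partialRow_self]; exact hu j
  | of_succ k hk ih =>
    rw [partialRow_step A u hk]
    exact Finset.sum_pos' (fun i _ => mul_nonneg (ih i).le (h0 k i j))
      ⟨j, Finset.mem_univ _, mul_pos (ih j) (hd k j)⟩

/-! ### Perron–Frobenius vectors at infinity -/

theorem vecMul_scaledFactor {S : Matrix (Fin n) (Fin n) ℝ} (hs : entrySum S = 1) (p : ℕ)
    (i : Fin n) (w : Fin n → ℝ) : w ᵥ* scaledFactor p i S = (p * w i) • S i := by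
  rw [scaledFactor, hs, sub_self, zero_smul, zero_add, vecMul_smul, single_mul_eq_vecMulVec,
    vecMul_vecMulVec, dotProduct_single, mul_one, smul_smul]

/-- At infinity the factors have rank one, so that the partial rows run through the rows of `S`
along the path, up to positive multiples. -/
theorem partialRow_scaledFactor {S : Matrix (Fin n) (Fin n) ℝ} (hs : entrySum S = 1)
    {p : ℕ → ℕ} (hp : ∀ k, 0 < p k) {i : ℕ → Fin n} {K : ℕ}
    (hedge : ∀ k < K, 0 < S (i (k + 1)) (i k)) {u : Fin n → ℝ} {m : ℕ} (hm : m ≤ K)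
    (h : ∃ c > (0 : ℝ), partialRow (fun k => scaledFactor (p k) (i k) S) K u m = c • S (i m))
    {k : ℕ} (hk : k ≤ m) :
    ∃ c > (0 : ℝ), partialRow (fun k => scaledFactor (p k) (i k) S) K u k = c • S (i k) := by
  induction hk using Nat.decreasingInduction with
  | self => exact h
  | of_succ k hk ih =>
    obtain ⟨c, hc, hcS⟩ := ih
    rw [partialRow_step _ u (hk.trans_le hm), hcS, vecMul_scaledFactor hs]
    exact ⟨p k * (c * S (i (k + 1)) (i k)),
      mul_pos (Nat.cast_pos.2 (hp k)) (mul_pos hc (hedge k (hk.trans_le hm))), rfl⟩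

theorem eq_smul_of_isPFVec {S : Matrix (Fin n) (Fin n) ℝ} (hs : entrySum S = 1)
    {p : ℕ → ℕ} (hp : ∀ k, 0 < p k) {i : ℕ → Fin n} {K : ℕ} (hK : 0 < K) (hi : i K = i 0)
    (hedge : ∀ k < K, 0 < S (i (k + 1)) (i k)) {u : Fin n → ℝ}
    (hu : IsPFVec (prodDown (fun k => scaledFactor (p k) (i k) S) K) (i (K - 1)) u) :
    ∃ c : ℝ, u = c • S (i 0) := by
  obtain ⟨m, rfl⟩ : ∃ m, K = m + 1 := ⟨K - 1, by omega⟩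
  obtain ⟨-, h1, h2⟩ := hu
  rw [Nat.add_sub_cancel] at h2
  have hpos : 0 < prodDown (fun k => scaledFactor (p k) (i k) S) (m + 1) (i m) (i m) := by
    -- The row of index `i m` of the product is obtained from the row vector `e_{i m}`, whose
    -- partial rows of index at most `m` are multiples of rows of `S`.
    obtain ⟨c, hc, hcS⟩ := partialRow_scaledFactor hs hp hedge (u := Pi.single (i m) 1) m.le_succ
      (by
        rw [partialRow_step _ _ m.lt_succ_self, partialRow_self, vecMul_scaledFactor hs]
        exact ⟨p m * (Pi.single (i m) 1 : Fin n → ℝ) (i m),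
          mul_pos (Nat.cast_pos.2 (hp m)) (by simp), rfl⟩) m.zero_le
    rw [partialRow_zero] at hcS
    have := congrFun hcS (i m)
    rw [single_one_vecMul] at this
    rw [show prodDown (fun k => scaledFactor (p k) (i k) S) (m + 1) (i m) (i m) = _ from this]
    have he := hedge m m.lt_succ_self
    rw [hi] at he
    exact mul_pos hc he
  have hsum := (hpos.trans_le h2).ne'
  set t := ∑ l, (u ᵥ* prodDown (fun k => scaledFactor (p k) (i k) S) (m + 1)) l
  rw [← partialRow_zero, partialRow_step _ _ m.succ_pos, vecMul_scaledFactor hs] at h1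
  exact ⟨t⁻¹ * (_ : ℝ), by rw [mul_smul, h1, smul_smul, inv_mul_cancel₀ hsum, one_smul]⟩

theorem isPFVec_row {S : Matrix (Fin n) (Fin n) ℝ} (h0 : ∀ i j, 0 ≤ S i j) (hs : entrySum S = 1)
    {p : ℕ → ℕ} (hp : ∀ k, 0 < p k) {i : ℕ → Fin n} {K : ℕ} (hK : 0 < K) (hi : i K = i 0)
    (hedge : ∀ k < K, 0 < S (i (k + 1)) (i k)) :
    0 < ∑ l, S (i 0) l ∧ IsPFVec (prodDown (fun k => scaledFactor (p k) (i k) S) K) (i (K - 1))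
      ((∑ l, S (i 0) l)⁻¹ • S (i 0)) := by
  have he : 0 < S (i 0) (i (K - 1)) := by
    have := hedge (K - 1) (by omega)
    rwa [Nat.sub_add_cancel hK, hi] at this
  have hsum : 0 < ∑ l, S (i 0) l :=
    Finset.sum_pos' (fun l _ => h0 _ l) ⟨_, Finset.mem_univ _, he⟩
  refine ⟨hsum, ?_⟩
  obtain ⟨c, -, hc⟩ := partialRow_scaledFactor hs hp hedge
    (u := (∑ l, S (i 0) l)⁻¹ • S (i 0)) le_rfl
    ⟨(∑ l, S (i 0) l)⁻¹, inv_pos.2 hsum, by rw [partialRow_self, hi]⟩ K.zero_le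
  have hN : ∀ K a b, 0 ≤ prodDown (fun k => scaledFactor (p k) (i k) S) K a b := by
    intro K
    induction K with
    | zero => intro a b; rw [prodDown, one_apply]; split_ifs <;> norm_num
    | succ K ih =>
      intro a b
      rw [prodDown, mul_apply]
      refine Finset.sum_nonneg fun l _ => mul_nonneg ?_ (ih l b)
      simp only [scaledFactor, hs, sub_self, zero_smul, zero_add, single_mul_eq_vecMulVec,
        Matrix.smul_apply, vecMulVec_apply, smul_eq_mul]
      refine mul_nonneg (Nat.cast_nonneg _) (mul_nonneg ?_ (h0 _ _))
      rw [Pi.single_apply]; split_ifs <;> norm_num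
  refine isPFVec_of_eigen (r := c * ∑ l, S (i 0) l) (hN K)
    ⟨fun l => mul_nonneg (inv_nonneg.2 hsum.le) (h0 _ l), ?_⟩ ?_
    (mul_pos (inv_pos.2 hsum) he).ne'
  · simp only [Pi.smul_apply, smul_eq_mul, ← Finset.mul_sum]
    exact inv_mul_cancel₀ hsum.ne'
  · rw [← partialRow_zero, hc, smul_smul, mul_assoc, mul_inv_cancel₀ hsum.ne', mul_one]

theorem existsUnique_isPFVec_row {S : Matrix (Fin n) (Fin n) ℝ} (h0 : ∀ i j, 0 ≤ S i j)
    (hs : entrySum S = 1) {p : ℕ → ℕ} (hp : ∀ k, 0 < p k) {i : ℕ → Fin n} {K : ℕ} (hK : 0 < K)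
    (hi : i K = i 0) (hedge : ∀ k < K, 0 < S (i (k + 1)) (i k)) :
    ∃! u, IsPFVec (prodDown (fun k => scaledFactor (p k) (i k) S) K) (i (K - 1)) u := by
  obtain ⟨hsum, hPF⟩ := isPFVec_row h0 hs hp hK hi hedge
  refine ⟨_, hPF, fun w hw => ?_⟩
  obtain ⟨c, rfl⟩ := eq_smul_of_isPFVec hs hp hK hi hedge hw
  have h1 := hw.1.2
  simp only [Pi.smul_apply, smul_eq_mul, ← Finset.mul_sum] at h1
  rw [eq_inv_of_mul_eq_one_left h1]

end Factors

section Extension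

open Matrix

variable {n : ℕ}

/-! ### Orbits at finite points -/

theorem prodDown_scaledFactor_fin (p : ℕ → ℕ) (i : ℕ → Fin n) (K : ℕ) (Ω : OO n) :
    prodDown (fun k => scaledFactor (p k) (i k) (OBar.radial (.fin Ω))) K =
      (1 + entrySum Ω.1)⁻¹ ^ K • prodDown (fun k => bQ (i k) Ω ^ p k) K := by
  simp only [scaledFactor_radial_fin, prodDown_smul]

theorem one_add_entrySum_inv_pos (Ω : OO n) : 0 < (1 + entrySum Ω.1)⁻¹ :=
  inv_pos.2 (by linarith [entrySum_nonneg Ω])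

theorem existsUnique_isPFVec_fin [NeZero n] {p : ℕ → ℕ} {i : ℕ → Fin n} {K : ℕ} {Ω : OO n}
    (hM : (prodDown (fun k => bQ (i k) Ω ^ p k) K).IsPrimitive) (j : Fin n) :
    ∃! u, IsPFVec
      (prodDown (fun k => scaledFactor (p k) (i k) (OBar.radial (.fin Ω))) K) j u := by
  rw [prodDown_scaledFactor_fin]
  exact existsUnique_isPFVec (isPrimitive_smul hM (pow_pos (one_add_entrySum_inv_pos Ω) K)) j

section Finite

variable {p : ℕ → ℕ} {i : ℕ → Fin n} {K : ℕ} {Ω : OO n} {j : Fin n} {u : Fin n → ℝ}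
  (hM : (prodDown (fun k => bQ (i k) Ω ^ p k) K).IsPrimitive)
  (hu : IsPFVec (prodDown (fun k => scaledFactor (p k) (i k) (OBar.radial (.fin Ω))) K) j u)

include hM hu

theorem bW_eq_perp_of_isPFVec [NeZero n] :
    bW (prodDown (fun k => bQ (i k) Ω ^ p k) K) = perp u := by
  have hs := pow_pos (one_add_entrySum_inv_pos Ω) K
  have h := hu.2.1
  set t := ∑ l, (u ᵥ* prodDown (fun k => scaledFactor (p k) (i k) (OBar.radial (.fin Ω))) K) l
  rw [prodDown_scaledFactor_fin, vecMul_smul] at h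
  refine bW_eq_perp hM hu.1 (r := ((1 + entrySum Ω.1)⁻¹ ^ K)⁻¹ * t) ?_
  rw [mul_smul, ← h, smul_smul, inv_mul_cancel₀ hs.ne', one_smul]

theorem partialRow_fin_pos {k : ℕ} (hk : k ≤ K) (l : Fin n) :
    0 < partialRow (fun k => scaledFactor (p k) (i k) (OBar.radial (.fin Ω))) K u k l := by
  have hs := one_add_entrySum_inv_pos Ω
  have h1 : ∀ k a b, (1 : Matrix (Fin n) (Fin n) ℝ) a b ≤ (bQ (i k) Ω ^ p k) a b := by
    intro k a b
    rw [← List.prod_replicate]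
    refine (le_list_prod_of_one_le _ fun A hA => ?_).1 a b
    rw [List.eq_of_mem_replicate hA]
    exact one_le_bQ _ _
  obtain ⟨a, ha⟩ := exists_ne_zero_of_mem_stdSimplex hu.1
  refine partialRow_pos (fun k a b => ?_) (fun k a => ?_)
    (eigen_pos (M := prodDown _ K) ?_ hu.1.1 ha hu.2.1) hk l
  · rw [scaledFactor_radial_fin]
    refine mul_nonneg hs.le (le_trans ?_ (h1 k a b))
    rw [one_apply]; split_ifs <;> norm_num
  · rw [scaledFactor_radial_fin]
    exact mul_pos hs (lt_of_lt_of_le (by simp) (h1 k a a))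
  · rw [prodDown_scaledFactor_fin]
    exact isPrimitive_smul hM (pow_pos hs K)

theorem prodDown_bQ_mulVec_eq {x : Fin n → ℝ} (hx : u ⬝ᵥ x = 0) :
    prodDown (fun k => bQ (i k) Ω ^ p k) K *ᵥ x =
      prodDown (fun k => projAlong (partialRow
        (fun k => scaledFactor (p k) (i k) (OBar.radial (.fin Ω))) K u (k + 1)) (i k)) K *ᵥ x := by
  refine prodDown_mulVec_eq (one_add_entrySum_inv_pos Ω).ne'
    (fun k => scaledFactor_radial_fin (p k) (i k) Ω) (fun k x => ?_) hu.2.1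
    (fun k hk => (partialRow_fin_pos hM hu hk _).ne') hx
  refine ⟨p k * (Ω.1 (i k) ⬝ᵥ x), ?_⟩
  rw [bQ_pow, add_mulVec, one_mulVec, smul_mulVec, single_mul_eq_vecMulVec, vecMulVec_mulVec,
    op_smul_eq_smul, smul_smul]

end Finite

theorem prodDown_projAlong_mem_perp {K : ℕ} (hK : 0 < K) {w : ℕ → Fin n → ℝ} {i : ℕ → Fin n}
    (h : w K (i (K - 1)) ≠ 0) (x : EuclideanSpace ℝ (Fin n)) :
    Matrix.toEuclideanLin (prodDown (fun k => projAlong (w (k + 1)) (i k)) K) x ∈ perp (w K) := by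
  obtain ⟨m, rfl⟩ : ∃ m, K = m + 1 := ⟨K - 1, by omega⟩
  rw [mem_perp, prodDown, Matrix.toLpLin_apply, ← mulVec_mulVec]
  exact dotProduct_projAlong h _

/-! ### Rays and paths -/

theorem BdOO.Rep.exists_smul {r : BdOO n} {Ω : OO n} (h : r.Rep Ω) :
    ∃ c : ℝ, 0 < c ∧ OBar.radial (.inf r) = c • Ω.1 ∧ entrySum (OBar.radial (.inf r)) = 1 := by
  have hpos := entrySum_pos h.1
  refine ⟨(entrySum Ω.1)⁻¹, inv_pos.2 hpos, OBar.radial_inf r Ω h, ?_⟩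
  rw [OBar.radial_inf r Ω h, entrySum_smul, inv_mul_cancel₀ hpos.ne']

theorem radial_edge_pos {v : Fin n} {γ : (⊤ : SimpleGraph (Fin n)).Walk v v} {r : BdOO n}
    (hr : r ∈ BdOOgamma γ) {k : ℕ} (hk : k < γ.length) :
    0 < OBar.radial (.inf r) (γ.getVert (k + 1)) (γ.getVert k) := by
  obtain ⟨c, hc, hS, -⟩ := r.rep_spec.exists_smul
  have he : (graph r.rep).Adj (γ.getVert k) (γ.getVert (k + 1)) :=
    hr _ (γ.mk_mem_edges_iff_exists.2 ⟨k, hk, rfl⟩)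
  rw [hS]
  exact mul_pos hc he.symm

theorem bM_apply {v : Fin n} (γ : (⊤ : SimpleGraph (Fin n)).Walk v v) (p : ℕ → ℕ) (Ω : OO n) :
    bM γ (fun k => p k) Ω = prodDown (fun k => bQ (γ.getVert k) Ω ^ p k) γ.length := by
  rw [← prod_reverse_ofFn, bM]
  have := map_list_prod (Pi.evalMonoidHom (fun _ : OO n => Matrix (Fin n) (Fin n) ℝ) Ω)
    (List.ofFn fun k : Fin γ.length => bQ (γ.getVert k.1) ^ p k).reverse
  rwa [List.map_reverse, List.map_ofFn] at this

theorem Pgamma_eq {v : Fin n} (γ : (⊤ : SimpleGraph (Fin n)).Walk v v) (Ω : OO n) :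
    Pgamma γ Ω =
      prodDown (fun k => projAlong (Ω.1 (γ.getVert (k + 1))) (γ.getVert k)) γ.length := by
  simp only [← prod_reverse_ofFn, Pgamma, Qproj_eq_projAlong]

theorem Pgamma_mem_rowPerp {v : Fin n} {γ : (⊤ : SimpleGraph (Fin n)).Walk v v}
    (hγ : 0 < γ.length) {r : BdOO n} (hr : r ∈ BdOOgamma γ) {Ω : OO n} (hΩ : r.Rep Ω)
    (x : EuclideanSpace ℝ (Fin n)) : Matrix.toEuclideanLin (Pgamma γ Ω) x ∈ rowPerp v Ω := by
  obtain ⟨c, hc, hS, -⟩ := hΩ.exists_smul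
  have he := radial_edge_pos hr (k := γ.length - 1) (by omega)
  rw [Nat.sub_add_cancel hγ, hS] at he
  have := prodDown_projAlong_mem_perp hγ (w := fun k => Ω.1 (γ.getVert k)) (i := γ.getVert)
    (fun h0 => he.ne' (mul_eq_zero_of_right c h0)) x
  rw [← Pgamma_eq, γ.getVert_length] at this
  exact this

/-- At infinity, the partial rows of a multiple `u` of the row of the starting vertex are multiples
of the rows along the path. The resulting composition of projections is therefore `P_γ`, for all
exponents and for every matrix on the ray. -/
theorem prodDown_projAlong_partialRow_inf {v : Fin n} {γ : (⊤ : SimpleGraph (Fin n)).Walk v v}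
    {r : BdOO n} (hr : r ∈ BdOOgamma γ) {Ω : OO n} (hΩ : r.Rep Ω) {p : ℕ → ℕ} (hp : ∀ k, 0 < p k)
    {u : Fin n → ℝ} {c : ℝ} (hc : 0 < c) (hu : u = c • OBar.radial (.inf r) v) :
    (∀ k < γ.length, 0 < partialRow (fun k => scaledFactor (p k) (γ.getVert k)
        (OBar.radial (.inf r))) γ.length u (k + 1) (γ.getVert k)) ∧
      prodDown (fun k => projAlong (partialRow (fun k => scaledFactor (p k) (γ.getVert k)
        (OBar.radial (.inf r))) γ.length u (k + 1)) (γ.getVert k)) γ.length = Pgamma γ Ω := by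
  obtain ⟨d, hd, hS, hs⟩ := hΩ.exists_smul
  have key : ∀ k < γ.length, ∃ e > (0 : ℝ), partialRow (fun k => scaledFactor (p k) (γ.getVert k)
      (OBar.radial (.inf r))) γ.length u (k + 1) =
        e • OBar.radial (.inf r) (γ.getVert (k + 1)) := fun k hk =>
    partialRow_scaledFactor hs hp (fun k hk => radial_edge_pos hr hk) le_rfl
      ⟨c, hc, by rw [partialRow_self, γ.getVert_length, hu]⟩ hk
  refine ⟨fun k hk => ?_, ?_⟩
  · obtain ⟨e, he, h⟩ := key k hk
    rw [h]
    exact mul_pos he (radial_edge_pos hr hk)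
  · rw [Pgamma_eq]
    refine prodDown_congr fun k hk => ?_
    obtain ⟨e, he, h⟩ := key k hk
    have hrow : OBar.radial (.inf r) (γ.getVert (k + 1)) = d • Ω.1 (γ.getVert (k + 1)) := by
      rw [hS]; rfl
    rw [h, hrow, projAlong_smul he.ne', projAlong_smul hd.ne']

theorem rowPerp_eq {v : Fin n} {r : BdOO n} {Ω : OO n} (hΩ : r.Rep Ω) {c : ℝ} (hc : c ≠ 0) :
    perp (c • OBar.radial (.inf r) v) = rowPerp v Ω := by
  obtain ⟨d, hd, hS, -⟩ := hΩ.exists_smul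
  have hrow : OBar.radial (.inf r) v = d • Ω.1 v := by rw [hS]; rfl
  rw [hrow, perp_smul hc, perp_smul hd.ne']
  rfl

theorem rowPerp_eq_of_rep {v : Fin n} {r : BdOO n} {Ω Ω' : OO n} (h : r.Rep Ω)
    (h' : r.Rep Ω') : rowPerp v Ω = rowPerp v Ω' := by
  rw [← rowPerp_eq h one_ne_zero, ← rowPerp_eq h' one_ne_zero]

theorem Pgamma_eq_of_rep {v : Fin n} {γ : (⊤ : SimpleGraph (Fin n)).Walk v v}
    {r : BdOO n} (hr : r ∈ BdOOgamma γ) {Ω Ω' : OO n} (h : r.Rep Ω) (h' : r.Rep Ω') :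
    Pgamma γ Ω = Pgamma γ Ω' := by
  rw [← (prodDown_projAlong_partialRow_inf hr h (fun _ => Nat.one_pos) one_pos rfl).2,
    (prodDown_projAlong_partialRow_inf hr h' (fun _ => Nat.one_pos) one_pos rfl).2]

end Extension

/-! ### The continuous extension -/

section Main

open Matrix

variable {n : ℕ} {v : Fin n} (γ : (⊤ : SimpleGraph (Fin n)).Walk v v)

theorem continuous_radial : Continuous (OBar.radial (n := n)) := continuous_induced_dom

/-- The partial rows along the path `γ`, at the point `S` of the unit ball. -/
noncomputable def pathRow (p : ℕ → ℕ) (S : Matrix (Fin n) (Fin n) ℝ) (u : Fin n → ℝ) (k : ℕ) :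
    Fin n → ℝ :=
  partialRow (fun k => scaledFactor (p k) (γ.getVert k) S) γ.length u k

/-- The composition of the projections onto the hyperplanes orthogonal to the partial rows. -/
noncomputable def pathProj (p : ℕ → ℕ) (S : Matrix (Fin n) (Fin n) ℝ) (u : Fin n → ℝ) :
    Matrix (Fin n) (Fin n) ℝ :=
  prodDown (fun k => projAlong (pathRow γ p S u (k + 1)) (γ.getVert k)) γ.length

theorem radial_row_ne_zero {γ : (⊤ : SimpleGraph (Fin n)).Walk v v} (hγ : 0 < γ.length)
    {r : BdOO n} (hr : r ∈ BdOOgamma γ) : OBar.radial (.inf r) v ≠ 0 := by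
  have he := radial_edge_pos hr (k := γ.length - 1) (by omega)
  rw [Nat.sub_add_cancel hγ, γ.getVert_length] at he
  exact fun h => he.ne' (congrFun h _)

/-- The Perron–Frobenius vectors of the products along a nonconstant path form a continuous family
over the connected matrices and the rays containing the path. At infinity they are proportional to
the row of the starting vertex. -/
theorem exists_continuous_pfVec {γ : (⊤ : SimpleGraph (Fin n)).Walk v v} (hγ : 0 < γ.length)
    {p : ℕ → ℕ} (hp : ∀ k, 0 < p k)
    (hM : ∀ Ω ∈ OOconn n, (prodDown (fun k => bQ (γ.getVert k) Ω ^ p k) γ.length).IsPrimitive) :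
    ∃ u : extDomain γ → Fin n → ℝ, Continuous u ∧
      (∀ x, IsPFVec (prodDown (fun k => scaledFactor (p k) (γ.getVert k) (OBar.radial x.1))
        γ.length) (γ.getVert (γ.length - 1)) (u x)) ∧
      ∀ x (r : BdOO n), r ∈ BdOOgamma γ → x.1 = .inf r →
        ∃ c : ℝ, 0 < c ∧ u x = c • OBar.radial (.inf r) v := by
  have : NeZero n := ⟨fun h => (h ▸ v).elim0⟩
  have hclosed : γ.getVert γ.length = γ.getVert 0 := by simp
  have hnn : ∀ (r : BdOO n) (a b : Fin n), 0 ≤ OBar.radial (.inf r) a b := fun r a b => by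
    obtain ⟨c, hc, hS, -⟩ := r.rep_spec.exists_smul
    rw [hS]
    exact mul_nonneg hc.le (r.rep.2.2.1 a b)
  have hex : ∀ x : extDomain γ, ∃! u, IsPFVec (prodDown (fun k => scaledFactor (p k)
      (γ.getVert k) (OBar.radial x.1)) γ.length) (γ.getVert (γ.length - 1)) u := by
    rintro ⟨_, ⟨Ω, hΩ, rfl⟩ | ⟨r, hr, rfl⟩⟩
    · exact existsUnique_isPFVec_fin (hM Ω hΩ) _
    · obtain ⟨c, hc, hS, hs⟩ := r.rep_spec.exists_smul
      exact existsUnique_isPFVec_row (hnn r) hs hp hγ hclosed fun k hk => radial_edge_pos hr hk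
  choose u hu huniq using hex
  have hrad : Continuous fun x : extDomain γ => OBar.radial x.1 :=
    continuous_radial.comp continuous_subtype_val
  refine ⟨u, continuous_of_isPFVec (continuous_prodDown _ fun k _ =>
    (continuous_scaledFactor _ _).comp hrad) _ hu huniq, hu, ?_⟩
  intro x r hr hx
  obtain ⟨c, hc, hS, hs⟩ := r.rep_spec.exists_smul
  obtain ⟨hsum, hPF⟩ := isPFVec_row (hnn r) hs hp hγ hclosed fun k hk => radial_edge_pos hr hk
  have h1 := huniq x ((∑ l, OBar.radial (.inf r) (γ.getVert 0) l)⁻¹ •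
    OBar.radial (.inf r) (γ.getVert 0)) (by rw [hx]; exact hPF)
  rw [γ.getVert_zero] at hsum h1
  exact ⟨_, inv_pos.2 hsum, h1.symm⟩

/-- The hyperplanes orthogonal to the Perron–Frobenius vectors, with the endomorphisms induced by
`pathProj`, are continuous over the whole domain; at finite points they are `W(M)` and `f(M)`, and
at infinity they are given by the row of the starting vertex and by `P_γ`. -/
theorem exists_extension {γ : (⊤ : SimpleGraph (Fin n)).Walk v v} (hγ : 0 < γ.length)
    (Wγ : BdOOgamma γ → Gr (n - 1) n) (hWγ : ∀ r, (Wγ r).1 = rowPerp v r.1.rep)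
    (fγ : BdOOgamma γ → EndGr (n - 1) n)
    (hfγ : ∀ r, (fγ r).1 = restrictEnd (rowPerp v r.1.rep) (Pgamma γ r.1.rep)
      fun x _ => Pgamma_mem_rowPerp hγ r.2 r.1.rep_spec x)
    {p : ℕ → ℕ} (hp : ∀ k, 0 < p k)
    (hM : ∀ Ω ∈ OOconn n, (bM γ (fun k => p k) Ω).IsPrimitive) :
    ∃ (W : OOconn n → Gr (n - 1) n) (f : OOconn n → EndGr (n - 1) n),
      (∀ Ω, (W Ω).1 = bW (bM γ (fun k => p k) Ω.1)) ∧
      (∀ Ω, (f Ω).1 = bf (bM γ (fun k => p k) Ω.1)) ∧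
      ExtendsContinuouslyBy γ W Wγ ∧ ExtendsContinuouslyBy γ f fγ := by
  have : NeZero n := ⟨fun h => (h ▸ v).elim0⟩
  simp only [bM_apply] at hM ⊢
  obtain ⟨u, hcont, hu, hinf⟩ := exists_continuous_pfVec hγ hp hM
  have hu0 : ∀ x, u x ≠ 0 := fun x h => by
    obtain ⟨i, hi⟩ := exists_ne_zero_of_mem_stdSimplex (hu x).1
    exact hi (by rw [h]; rfl)
  have hw_pos : ∀ x, ∀ k < γ.length,
      0 < pathRow γ p (OBar.radial x.1) (u x) (k + 1) (γ.getVert k) := by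
    intro x k hk
    have hux := hu x
    rcases x.2 with ⟨Ω, hΩ, hx⟩ | ⟨r, hr, hx⟩
    · rw [← hx] at hux ⊢
      exact partialRow_fin_pos (hM Ω hΩ) hux (Nat.succ_le_of_lt hk) _
    · obtain ⟨c, hc, h⟩ := hinf x r hr hx.symm
      rw [← hx]
      exact (prodDown_projAlong_partialRow_inf hr r.rep_spec hp hc h).1 k hk
  have hrad : Continuous fun x : extDomain γ => OBar.radial x.1 :=
    continuous_radial.comp continuous_subtype_val
  have hwcont : ∀ k, Continuous fun x => pathRow γ p (OBar.radial x.1) (u x) k := fun k =>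
    hcont.matrix_vecMul (continuous_prodDown _ fun j _ => (continuous_scaledFactor _ _).comp hrad)
  have hPcont : Continuous fun x => pathProj γ p (OBar.radial x.1) (u x) :=
    continuous_prodDown _ fun k hk => by
      have h1 : Continuous fun x =>
          (pathRow γ p (OBar.radial x.1) (u x) (k + 1) (γ.getVert k))⁻¹ :=
        ((continuous_apply _).comp (hwcont _)).inv₀ fun x => (hw_pos x k hk).ne'
      exact continuous_const.sub (h1.smul (continuous_const.matrix_vecMulVec (hwcont _)))
  have hPinv : ∀ x, ∀ y ∈ perp (u x),
      Matrix.toEuclideanLin (pathProj γ p (OBar.radial x.1) (u x)) y ∈ perp (u x) := by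
    intro x y _
    have h1 := hw_pos x (γ.length - 1) (by omega)
    rw [Nat.sub_add_cancel hγ] at h1
    have := prodDown_projAlong_mem_perp hγ h1.ne' y
    rwa [show pathRow γ p (OBar.radial x.1) (u x) γ.length = u x from
      partialRow_self _ _ _] at this
  have hbW : ∀ (x : extDomain γ) (Ω : OO n), Ω ∈ OOconn n → x.1 = .fin Ω →
      bW (prodDown (fun k => bQ (γ.getVert k) Ω ^ p k) γ.length) = perp (u x) := by
    intro x Ω hΩ hx
    have hux := hu x
    rw [hx] at hux
    exact bW_eq_perp_of_isPFVec (hM Ω hΩ) hux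
  have hfin : ∀ (x : extDomain γ) (Ω : OO n), Ω ∈ OOconn n → x.1 = .fin Ω → ∀ y : Fin n → ℝ,
      u x ⬝ᵥ y = 0 → prodDown (fun k => bQ (γ.getVert k) Ω ^ p k) γ.length *ᵥ y =
        pathProj γ p (OBar.radial x.1) (u x) *ᵥ y := by
    intro x Ω hΩ hx y hy
    have hux := hu x
    rw [hx] at hux ⊢
    exact prodDown_bQ_mulVec_eq (hM Ω hΩ) hux hy
  have hinfP : ∀ (x : extDomain γ) (r : BdOO n), r ∈ BdOOgamma γ → x.1 = .inf r →
      perp (u x) = rowPerp v r.rep ∧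
        pathProj γ p (OBar.radial x.1) (u x) = Pgamma γ r.rep := by
    intro x r hr hx
    obtain ⟨c, hc, h⟩ := hinf x r hr hx
    rw [hx]
    refine ⟨?_, (prodDown_projAlong_partialRow_inf hr r.rep_spec hp hc h).2⟩
    rw [h, rowPerp_eq r.rep_spec hc.ne']
  have hrank : ∀ Ω : OOconn n, Module.finrank ℝ
      (bW (prodDown (fun k => bQ (γ.getVert k) Ω.1 ^ p k) γ.length)) = n - 1 := fun Ω => by
    rw [hbW ⟨.fin Ω.1, Or.inl ⟨Ω.1, Ω.2, rfl⟩⟩ Ω.1 Ω.2 rfl]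
    exact finrank_perp (hu0 _)
  refine ⟨fun Ω => ⟨_, hrank Ω⟩, fun Ω => ⟨bf _, hrank Ω⟩, fun Ω => rfl, fun Ω => rfl,
    ⟨fun x => perpGr (u x) (hu0 x), continuous_perpGr hcont hu0, fun Ω h => ?_, fun r h => ?_⟩,
    ⟨fun x => perpEnd (u x) (hu0 x) _ (hPinv x), continuous_perpEnd hcont hu0 hPcont hPinv,
      fun Ω h => ?_, fun r h => ?_⟩⟩
  · exact Subtype.ext (hbW ⟨.fin Ω, Or.inl ⟨Ω, h, rfl⟩⟩ Ω h rfl).symm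
  · exact Subtype.ext ((hinfP ⟨.inf r, Or.inr ⟨r, h, rfl⟩⟩ r h rfl).1.trans (hWγ ⟨r, h⟩).symm)
  · have hb := hbW ⟨.fin Ω, Or.inl ⟨Ω, h, rfl⟩⟩ Ω h rfl
    refine Subtype.ext (Eq.symm ?_)
    exact restrictEnd_congr (h := bW_invariant _) hb fun x hx =>
      hfin _ Ω h rfl _ (mem_perp.1 (hb ▸ hx))
  · obtain ⟨h1, h2⟩ := hinfP ⟨.inf r, Or.inr ⟨r, h, rfl⟩⟩ r h rfl
    refine Subtype.ext (Eq.trans ?_ (hfγ ⟨r, h⟩).symm)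
    exact restrictEnd_congr h1 fun x _ => congrArg (· *ᵥ x.ofLp) h2

/-- The empty product is the identity, which is primitive only in dimension one. -/
theorem eq_one_of_nil {γ : (⊤ : SimpleGraph (Fin n)).Walk v v} (hγ : γ.length = 0)
    {p : Fin γ.length → ℕ} (hM : bM γ p ∈ GammaGen n) : n = 1 := by
  have : NeZero n := ⟨fun h => (h ▸ v).elim0⟩
  have h1 : bM γ p (completeOO n) = 1 := by
    have : bM γ p = 1 := by
      rw [bM]
      have : (List.ofFn fun k : Fin γ.length => bQ (γ.getVert k.1) ^ p k) = [] :=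
        List.length_eq_zero_iff.1 (by simpa using hγ)
      rw [this]
      rfl
    rw [this]; rfl
  obtain ⟨-, k, -, hk⟩ := isPrimitive_of_mem_gammaGen hM completeOO_mem_OOconn
  rw [h1, one_pow] at hk
  have : Subsingleton (Fin n) := ⟨fun a b => by
    by_contra hab
    simpa [hab] using hk a b⟩
  have h2 := Fintype.card_le_one_iff_subsingleton.2 this
  rw [Fintype.card_fin] at h2
  have := NeZero.pos n
  omega

end Main

section Degenerate

variable {n : ℕ}

/-! ### The constant path -/

theorem finrank_bW [NeZero n] {M : Matrix (Fin n) (Fin n) ℝ} (hM : M.IsPrimitive) :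
    Module.finrank ℝ (bW M) = n - 1 := by
  obtain ⟨u, hu, r, hr⟩ := exists_left_eigen hM
  rw [bW_eq_perp hM hu hr]
  obtain ⟨i, hi⟩ := exists_ne_zero_of_mem_stdSimplex hu
  exact finrank_perp fun h => hi (congrFun h i)

instance : Subsingleton (OO 1) := ⟨fun Ω Ω' => Subtype.ext <| by
  ext i j
  rw [Subsingleton.elim j i, Ω.2.2.2, Ω'.2.2.2]⟩

instance : IsEmpty (BdOO 1) := ⟨fun r => r.rep_spec.1 <| by
  ext i j
  rw [Subsingleton.elim j i, r.rep.2.2.2]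
  rfl⟩

/-- For `n = 1` the space `𝕆` is a point and has no boundary at infinity. -/
theorem extendsContinuouslyBy_of_one {v : Fin 1} (γ : (⊤ : SimpleGraph (Fin 1)).Walk v v)
    {X : Type*} [TopologicalSpace X] (F : OOconn 1 → X) (F₀ : BdOOgamma γ → X) :
    ExtendsContinuouslyBy γ F F₀ :=
  ⟨fun _ => F ⟨completeOO 1, completeOO_mem_OOconn⟩, continuous_const,
    fun _ _ => congrArg F (Subtype.ext (Subsingleton.elim _ _)), fun r => isEmptyElim r⟩

end Degenerate

end Penner

theorem mainTheorem7 {n : ℕ} {v : Fin n} (γ : (⊤ : SimpleGraph (Fin n)).Walk v v) :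
    -- the extensions are chosen before the exponents
    ∃ (Wγ : Penner.BdOOgamma γ → Penner.Gr (n - 1) n)
      (fγ : Penner.BdOOgamma γ → Penner.EndGr (n - 1) n),
    ∀ p : Fin γ.length → ℕ, (∀ k, 0 < p k) → Penner.bM γ p ∈ Penner.GammaGen n →
      -- the functions to be extended are well defined
      (∀ Ω ∈ Penner.OOconn n, (Penner.bM γ p Ω).IsPrimitive) ∧
      ∃ (W : Penner.OOconn n → Penner.Gr (n - 1) n)
        (f : Penner.OOconn n → Penner.EndGr (n - 1) n),
        (∀ Ω, (W Ω).1 = Penner.bW (Penner.bM γ p Ω.1)) ∧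
        (∀ Ω, (f Ω).1 = Penner.bf (Penner.bM γ p Ω.1)) ∧
        -- continuous extensions
        Penner.ExtendsContinuouslyBy γ W Wγ ∧
        Penner.ExtendsContinuouslyBy γ f fγ ∧
        -- description of the extensions, for every representative of the ray
        ∀ (r : Penner.BdOOgamma γ) (Ω : Penner.OO n), r.1.Rep Ω →
          (Wγ r).1 = Penner.rowPerp v Ω ∧
          ∃ hinv : ∀ x ∈ Penner.rowPerp v Ω,
              Matrix.toEuclideanLin (Penner.Pgamma γ Ω) x ∈ Penner.rowPerp v Ω,
            (fγ r).1 = ⟨Penner.rowPerp v Ω,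
              (Matrix.toEuclideanLin (Penner.Pgamma γ Ω)).restrict hinv⟩ := by
  open Penner in
  have hn : NeZero n := ⟨fun h => (h ▸ v).elim0⟩
  rcases Nat.eq_zero_or_pos γ.length with hγ | hγ
  · -- For the constant path, generality forces `n = 1`, and the chosen maps do not matter.
    have hv : (Pi.single v 1 : Fin n → ℝ) ≠ 0 := by simp
    refine ⟨fun _ => perpGr _ hv, fun _ => perpEnd _ hv 0 (by simp), fun p _ hgen => ?_⟩
    have hM := fun Ω (hΩ : Ω ∈ OOconn n) => isPrimitive_of_mem_gammaGen hgen hΩ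
    obtain rfl := eq_one_of_nil hγ hgen
    exact ⟨hM, fun Ω => ⟨_, finrank_bW (hM Ω.1 Ω.2)⟩, fun Ω => ⟨bf _, finrank_bW (hM Ω.1 Ω.2)⟩,
      fun _ => rfl, fun _ => rfl, extendsContinuouslyBy_of_one γ _ _,
      extendsContinuouslyBy_of_one γ _ _, fun r => isEmptyElim r.1⟩
  · have hrank : ∀ r : BdOOgamma γ, Module.finrank ℝ (rowPerp v r.1.rep) = n - 1 := fun r => by
      rw [← rowPerp_eq r.1.rep_spec one_ne_zero, one_smul]
      exact finrank_perp (radial_row_ne_zero hγ r.2)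
    obtain ⟨Wγ, hWγ⟩ : ∃ Wγ : BdOOgamma γ → Gr (n - 1) n, ∀ r, (Wγ r).1 = rowPerp v r.1.rep :=
      ⟨fun r => ⟨_, hrank r⟩, fun _ => rfl⟩
    obtain ⟨fγ, hfγ⟩ : ∃ fγ : BdOOgamma γ → EndGr (n - 1) n, ∀ r, (fγ r).1 =
        restrictEnd (rowPerp v r.1.rep) (Pgamma γ r.1.rep)
          fun x _ => Pgamma_mem_rowPerp hγ r.2 r.1.rep_spec x :=
      ⟨fun r => ⟨restrictEnd _ _ fun x _ => Pgamma_mem_rowPerp hγ r.2 r.1.rep_spec x, hrank r⟩,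
        fun _ => rfl⟩
    refine ⟨Wγ, fγ, fun p hp hgen => ?_⟩
    have hM := fun Ω (hΩ : Ω ∈ OOconn n) => isPrimitive_of_mem_gammaGen hgen hΩ
    obtain ⟨q, hq, rfl⟩ : ∃ q : ℕ → ℕ, (∀ k, 0 < q k) ∧ p = fun k => q k.1 := by
      refine ⟨fun k => if h : k < γ.length then p ⟨k, h⟩ else 1, fun k => ?_, ?_⟩
      · dsimp only
        split_ifs
        exacts [hp _, Nat.one_pos]
      · funext k
        simp
    obtain ⟨W, f, hW, hf, hWc, hfc⟩ := exists_extension hγ Wγ hWγ fγ hfγ hq hM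
    refine ⟨hM, W, f, hW, hf, hWc, hfc, fun r Ω hΩ =>
      ⟨(hWγ r).trans (rowPerp_eq_of_rep r.1.rep_spec hΩ),
        fun x _ => Pgamma_mem_rowPerp hγ r.2 hΩ x, (hfγ r).trans ?_⟩⟩
    exact restrictEnd_congr (rowPerp_eq_of_rep r.1.rep_spec hΩ) fun x _ =>
      congrArg (fun P => Matrix.mulVec P x.ofLp) (Pgamma_eq_of_rep r.2 r.1.rep_spec hΩ)
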